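/- Let $(X_n)_{n\ge 1}$ be independent standard Gaussian random variables (mean $0$, variance $1$) on a probability space, and let $F(\sigma)=\sum_{n=1}^\infty X_n n^{-\sigma}$, a random Dirichlet series which almost surely converges for every real $\sigma>1/2$. For $T>1/2$ let $N(T,\infty)\in\{0,1,2,\dots\}\cup\{\infty\}$ be the number of real zeros of $F$ in $[T,\infty)$, counted without multiplicity. Then, almost surely, $$\limsup_{T\to 1/2^+}\frac{N(T,\infty)}{\log\left(\frac{1}{T-1/2}\right)\log\log\left(\frac{1}{T-1/2}\right)}<\infty,$$ and, almost surely, for every $\epsilon>0$, $$\liminf_{T\to 1/2^+}\frac{N(T,\infty)}{\left(\log\left(\frac{1}{T-1/2}\right)\right)^{1/2-\epsilon}}=\infty.$$ -/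

import Mathlib

open MeasureTheory ProbabilityTheory Filter Topology
open scoped ENNReal

noncomputable section

/-- The partial sum `∑_{n=1}^{N} x_n / n ^ σ`, where the coefficient `x_n` (`n ≥ 1`) is stored as
`x (n - 1)`. -/
def dirichletPartialSum (x : ℕ → ℝ) (σ : ℝ) (N : ℕ) : ℝ :=
  ∑ k ∈ Finset.range N, x k / ((k : ℝ) + 1) ^ σ

/-- `σ` is a real zero of the Dirichlet series `F(σ) = ∑_{n ≥ 1} x_n / n ^ σ`: the series converges
(in the usual, possibly conditional, sense) at `σ`, and its sum there is `0`. -/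
def IsRealZero (x : ℕ → ℝ) (σ : ℝ) : Prop :=
  Tendsto (dirichletPartialSum x σ) atTop (𝓝 0)

/-- `N(T, ∞)`: the number of real zeros of the Dirichlet series in `[T, ∞)`, each counted once;
the value is `⊤` if there are infinitely many. -/
def numRealZeros (x : ℕ → ℝ) (T : ℝ) : ℕ∞ :=
  {σ : ℝ | T ≤ σ ∧ IsRealZero x σ}.encard

/-- The scale `log (1 / (T - 1/2))`. -/
def logScale (T : ℝ) : ℝ := Real.log (1 / (T - 1 / 2))

end

/-! Almost surely the partial sums of the coefficients are `O(N ^ (1 / 2 + ε))`, so summation by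
parts makes `F` holomorphic on `Re z > 1 / 2`. Everything then compares `F` at distance `s` from `1
/ 2` with its standard deviation, of order `1 / √s`. Write `L = logScale T`.

Upper bound: at `1 / 2 + s`, `s = (7 / 8) ^ k`, Borel–Cantelli shows that `|F|` is eventually at
least `(k + 1) ^ (-2) / √s`, while its mean square on the circle of radius `s / 2` is at most `(k +
1) ^ 2 * (1 + 1 / s)`. By `norm_sq_center_le_of_zeros`, `m` zeros in the concentric disc of radius
`s / 8` force a ratio of at least `9 ^ m`. Hence each interval `[1 / 2 + 7 / 8 * s, 1 / 2 + s]`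
carries `O(log k)` zeros, and `O(L)` intervals reach down to `T`.

Lower bound: at `s = exp (-(j + 1) ^ 2)` almost all the variance comes from the `n` with `log log n`
within about `j + 1` of `(j + 1) ^ 2`. These blocks are disjoint, so the signs of `F` at the sample
points are eventually those of independent block sums (`ae_eventually_sign_eq`). By the strong law a
positive proportion of pairs of neighbouring samples change sign (`ae_tendsto_signChange`). About
`√L` samples lie above `T`, so there are at least a constant times `√L` zeros. -/

/-! ### Deterministic analysis: convergence, holomorphy and finiteness of zeros. -/

/-- The coefficients cancel almost like the square root of the length of the sum. -/
def SqrtCancellation (x : ℕ → ℝ) : Prop :=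
  ∀ ε : ℝ, 0 < ε → ∃ C : ℝ, 0 ≤ C ∧ ∀ N : ℕ,
    |∑ k ∈ Finset.range N, x k| ≤ C * ((N : ℝ) + 1) ^ (1 / 2 + ε)

/-- Partial sums of the Dirichlet series at a complex point. -/
noncomputable def complexPartialSum (x : ℕ → ℝ) (z : ℂ) (N : ℕ) : ℂ :=
  ∑ k ∈ Finset.range N, (x k : ℂ) * ((k : ℂ) + 1) ^ (-z)

/-- The terms of the Dirichlet series after summation by parts. -/
noncomputable def abelTerm (x : ℕ → ℝ) (k : ℕ) (z : ℂ) : ℂ :=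
  ((∑ i ∈ Finset.range (k + 1), x i : ℝ) : ℂ) *
    (((k : ℂ) + 1) ^ (-z) - (((k + 1 : ℕ) : ℂ) + 1) ^ (-z))

/-- The sum of the Dirichlet series, as the sum of the series obtained by summation by parts. -/
noncomputable def dirichletFun (x : ℕ → ℝ) (z : ℂ) : ℂ := ∑' k, abelTerm x k z

lemma complexPartialSum_eq (x : ℕ → ℝ) (z : ℂ) (N : ℕ) :
    complexPartialSum x z N =
      ((∑ i ∈ Finset.range N, x i : ℝ) : ℂ) * ((N : ℂ) + 1) ^ (-z) +
        ∑ k ∈ Finset.range N, abelTerm x k z := by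
  induction N with
  | zero => simp [complexPartialSum]
  | succ N ih =>
    have h : complexPartialSum x z (N + 1) =
        complexPartialSum x z N + (x N : ℂ) * ((N : ℂ) + 1) ^ (-z) := by
      simp [complexPartialSum, Finset.sum_range_succ]
    rw [h, ih, Finset.sum_range_succ (fun k => abelTerm x k z), abelTerm,
      Finset.sum_range_succ x]
    push_cast
    ring

lemma norm_natCast_add_one_cpow (k : ℕ) (z : ℂ) :
    ‖((k : ℂ) + 1) ^ (-z)‖ = ((k : ℝ) + 1) ^ (-z.re) := by
  have h := Complex.norm_cpow_eq_rpow_re_of_pos (x := (k : ℝ) + 1) (by positivity) (-z)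
  simpa using h

/-- Mean value inequality on `[k + 1, k + 2]`: differencing gains one power of `k`, at the cost of a
factor `‖z‖`. -/
lemma norm_cpow_sub_cpow_succ_le (k : ℕ) {z : ℂ} (hz : 0 ≤ z.re) :
    ‖((k : ℂ) + 1) ^ (-z) - (((k + 1 : ℕ) : ℂ) + 1) ^ (-z)‖ ≤
      ‖z‖ * ((k : ℝ) + 1) ^ (-z.re - 1) := by
  have hder : ∀ t ∈ Set.Icc ((k : ℝ) + 1) ((k : ℝ) + 2),
      HasDerivWithinAt (fun t : ℝ => (t : ℂ) ^ (-z)) (-z * (t : ℂ) ^ (-z - 1))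
        (Set.Icc ((k : ℝ) + 1) ((k : ℝ) + 2)) t := by
    intro t ht
    have ht0 : 0 < t := lt_of_lt_of_le (by positivity) ht.1
    by_cases hz0 : z = 0
    · subst hz0
      simpa using (hasDerivAt_const t (1 : ℂ)).hasDerivWithinAt
    exact (hasDerivAt_ofReal_cpow_const ht0.ne' (neg_ne_zero.2 hz0)).hasDerivWithinAt
  have hbd : ∀ t ∈ Set.Ico ((k : ℝ) + 1) ((k : ℝ) + 2),
      ‖-z * (t : ℂ) ^ (-z - 1)‖ ≤ ‖z‖ * ((k : ℝ) + 1) ^ (-z.re - 1) := by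
    intro t ht
    have hk : (0 : ℝ) < (k : ℝ) + 1 := by positivity
    have ht0 : 0 < t := lt_of_lt_of_le hk ht.1
    rw [norm_mul, norm_neg, Complex.norm_cpow_eq_rpow_re_of_pos ht0]
    simp only [Complex.sub_re, Complex.neg_re, Complex.one_re]
    gcongr ‖z‖ * ?_
    exact Real.rpow_le_rpow_of_nonpos hk ht.1 (by linarith)
  have := norm_image_sub_le_of_norm_deriv_le_segment' hder hbd ((k : ℝ) + 2)
    ⟨by linarith, le_rfl⟩
  rw [norm_sub_rev]
  have e1 : ((((k + 1 : ℕ) : ℂ)) + 1) = (((k : ℝ) + 2 : ℝ) : ℂ) := by push_cast; ring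
  have e2 : ((k : ℂ) + 1) = (((k : ℝ) + 1 : ℝ) : ℂ) := by push_cast; ring
  rw [e1, e2]
  refine this.trans (le_of_eq ?_)
  ring

namespace SqrtCancellation

variable {x : ℕ → ℝ}

/-- Half of the gap `a - 1 / 2` is spent as the `ε` of the cancellation bound; the other half leaves
an exponent below `-1`. Apart from `‖z‖` the bound is uniform on the half-plane, as the Weierstrass
test needs. -/
lemma norm_abelTerm_le (hx : SqrtCancellation x) {a : ℝ} (ha : 1 / 2 < a) :
    ∃ C : ℝ, 0 ≤ C ∧ ∀ (z : ℂ), a ≤ z.re → ∀ k : ℕ,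
      ‖abelTerm x k z‖ ≤ ‖z‖ * (C * ((k : ℝ) + 1) ^ (-(1 + (a - 1 / 2) / 2))) := by
  obtain ⟨C, hC, h⟩ := hx ((a - 1 / 2) / 2) (by linarith)
  refine ⟨C * 2 ^ (1 / 2 + (a - 1 / 2) / 2), by positivity, fun z hz k => ?_⟩
  have hk : (0 : ℝ) < (k : ℝ) + 1 := by positivity
  rw [abelTerm, norm_mul, Complex.norm_real, Real.norm_eq_abs]
  calc |∑ i ∈ Finset.range (k + 1), x i| *
        ‖((k : ℂ) + 1) ^ (-z) - (((k + 1 : ℕ) : ℂ) + 1) ^ (-z)‖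
      ≤ (C * (2 * ((k : ℝ) + 1)) ^ (1 / 2 + (a - 1 / 2) / 2)) *
          (‖z‖ * ((k : ℝ) + 1) ^ (-z.re - 1)) := by
        refine mul_le_mul ((h (k + 1)).trans ?_) (norm_cpow_sub_cpow_succ_le k (by linarith))
          (norm_nonneg _) (by positivity)
        gcongr
        push_cast
        linarith
    _ = ‖z‖ * (C * 2 ^ (1 / 2 + (a - 1 / 2) / 2) *
          (((k : ℝ) + 1) ^ (1 / 2 + (a - 1 / 2) / 2 + (-z.re - 1)))) := by
        rw [Real.mul_rpow (by norm_num) hk.le, Real.rpow_add hk _ (-z.re - 1)]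
        ring
    _ ≤ _ := by
        gcongr
        · linarith
        · linarith

lemma summable_rpow_neg {p : ℝ} (hp : 1 < p) : Summable fun k : ℕ => ((k : ℝ) + 1) ^ (-p) := by
  have := (summable_nat_add_iff 1).2 (Real.summable_nat_rpow.2 (show -p < -1 by linarith))
  simpa using this

lemma summable_abelTerm (hx : SqrtCancellation x) {z : ℂ} (hz : 1 / 2 < z.re) :
    Summable fun k => abelTerm x k z := by
  obtain ⟨C, hC, h⟩ := hx.norm_abelTerm_le hz
  refine Summable.of_norm_bounded (((summable_rpow_neg ?_).mul_left C).mul_left ‖z‖)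
    (fun k => h z le_rfl k)
  linarith

lemma tendsto_complexPartialSum (hx : SqrtCancellation x) {z : ℂ} (hz : 1 / 2 < z.re) :
    Tendsto (complexPartialSum x z) atTop (𝓝 (dirichletFun x z)) := by
  have h1 := (hx.summable_abelTerm hz).hasSum.tendsto_sum_nat
  obtain ⟨C, hC, h⟩ := hx ((z.re - 1 / 2) / 2) (by linarith)
  have h2 : Tendsto (fun N : ℕ => ((∑ i ∈ Finset.range N, x i : ℝ) : ℂ) *
      ((N : ℂ) + 1) ^ (-z)) atTop (𝓝 0) := by
    have h3 : Tendsto (fun N : ℕ => C * ((N : ℝ) + 1) ^ (-((z.re - 1 / 2) / 2))) atTop (𝓝 0) := by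
      have := (tendsto_rpow_neg_atTop (show 0 < (z.re - 1 / 2) / 2 by linarith)).comp
        (tendsto_atTop_add_const_right atTop (1 : ℝ) tendsto_natCast_atTop_atTop)
      simpa [Function.comp_def] using this.const_mul C
    refine squeeze_zero_norm (fun N => ?_) h3
    have hN : (0 : ℝ) < (N : ℝ) + 1 := by positivity
    rw [norm_mul, norm_natCast_add_one_cpow, Complex.norm_real, Real.norm_eq_abs]
    calc _ ≤ C * ((N : ℝ) + 1) ^ (1 / 2 + (z.re - 1 / 2) / 2) * ((N : ℝ) + 1) ^ (-z.re) := by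
          gcongr
          exact h N
      _ = _ := by
          rw [mul_assoc, ← Real.rpow_add hN]
          congr 2
          ring
  have h4 := h2.add h1
  rw [zero_add] at h4
  exact h4.congr fun N => (complexPartialSum_eq x z N).symm

lemma differentiableOn_dirichletFun (hx : SqrtCancellation x) :
    DifferentiableOn ℂ (dirichletFun x) {z | 1 / 2 < z.re} := by
  intro w hw
  have hw : 1 / 2 < w.re := hw
  set a := (1 / 2 + w.re) / 2 with ha
  have haw : a < w.re := by linarith
  have ha2 : 1 / 2 < a := by linarith
  -- The ball bounds the factor `‖z‖`, so that one summable majorant serves all of `U`.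
  set U : Set ℂ := {z | a < z.re} ∩ Metric.ball 0 (‖w‖ + 1) with hU
  have hUo : IsOpen U := (isOpen_lt continuous_const Complex.continuous_re).inter Metric.isOpen_ball
  have hwU : w ∈ U := ⟨haw, by simp⟩
  obtain ⟨C, hC, h⟩ := hx.norm_abelTerm_le ha2
  have hd : DifferentiableOn ℂ (fun z => ∑' k, abelTerm x k z) U := by
    refine Complex.differentiableOn_tsum_of_summable_norm
      (((summable_rpow_neg (p := 1 + (a - 1 / 2) / 2) (by linarith)).mul_left C).mul_left
        (‖w‖ + 1)) (fun k => ?_) hUo (fun k z hz => ?_)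
    · have hk : ∀ k : ℕ, Differentiable ℂ fun z : ℂ => ((k : ℂ) + 1) ^ (-z) := fun k =>
        differentiable_id.neg.const_cpow (Or.inl (by exact_mod_cast Nat.succ_ne_zero k))
      exact (((hk k).sub (hk (k + 1))).const_mul _).differentiableOn
    · refine (h z (le_of_lt hz.1) k).trans ?_
      have : ‖z‖ ≤ ‖w‖ + 1 := by have := hz.2; simp at this; exact this.le
      gcongr
  exact (hd.differentiableAt (hUo.mem_nhds hwU)).differentiableWithinAt

end SqrtCancellation

lemma complexPartialSum_ofReal (x : ℕ → ℝ) (σ : ℝ) (N : ℕ) :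
    complexPartialSum x σ N = (dirichletPartialSum x σ N : ℝ) := by
  rw [complexPartialSum, dirichletPartialSum, Complex.ofReal_sum]
  refine Finset.sum_congr rfl fun k _ => ?_
  have hk : (0 : ℝ) ≤ (k : ℝ) + 1 := by positivity
  rw [div_eq_mul_inv, ← Real.rpow_neg hk, Complex.ofReal_mul, Complex.ofReal_cpow hk]
  push_cast
  rfl

namespace SqrtCancellation

variable {x : ℕ → ℝ}

lemma tendsto_dirichletPartialSum (hx : SqrtCancellation x) {σ : ℝ} (hσ : 1 / 2 < σ) :
    Tendsto (dirichletPartialSum x σ) atTop (𝓝 (dirichletFun x σ).re) := by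
  have h := hx.tendsto_complexPartialSum (z := σ) (by simpa using hσ)
  have := (Complex.continuous_re.tendsto _).comp h
  simpa [Function.comp_def, complexPartialSum_ofReal] using this

lemma dirichletFun_ofReal (hx : SqrtCancellation x) {σ : ℝ} (hσ : 1 / 2 < σ) :
    dirichletFun x σ = ((dirichletFun x σ).re : ℂ) := by
  have h := hx.tendsto_complexPartialSum (z := σ) (by simpa using hσ)
  have h2 := (Complex.continuous_ofReal.tendsto _).comp (hx.tendsto_dirichletPartialSum hσ)
  refine tendsto_nhds_unique h (h2.congr fun N => ?_)
  simp [complexPartialSum_ofReal]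

lemma isRealZero_iff (hx : SqrtCancellation x) {σ : ℝ} (hσ : 1 / 2 < σ) :
    IsRealZero x σ ↔ dirichletFun x σ = 0 := by
  have h := hx.tendsto_dirichletPartialSum hσ
  constructor
  · intro h0
    rw [hx.dirichletFun_ofReal hσ, tendsto_nhds_unique h h0]
    simp
  · intro h0
    rw [h0] at h
    exact h

lemma continuousOn_re_dirichletFun (hx : SqrtCancellation x) :
    ContinuousOn (fun σ : ℝ => (dirichletFun x σ).re) (Set.Ioi (1 / 2)) := by
  refine Complex.continuous_re.comp_continuousOn
    (hx.differentiableOn_dirichletFun.continuousOn.comp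
      Complex.continuous_ofReal.continuousOn fun σ hσ => ?_)
  simpa using hσ

/-- The series tends to its first coefficient at infinity. -/
lemma tendsto_re_dirichletFun_atTop (hx : SqrtCancellation x) :
    Tendsto (fun σ : ℝ => (dirichletFun x σ).re) atTop (𝓝 (x 0)) := by
  obtain ⟨C, hC, h⟩ := hx (1 / 2) (by norm_num)
  have hterm : ∀ k, |x k| ≤ 4 * C * ((k : ℝ) + 1) := by
    intro k
    have h1 := h k
    have h2 := h (k + 1)
    norm_num at h1 h2
    have h3 : x k = (∑ i ∈ Finset.range (k + 1), x i) - ∑ i ∈ Finset.range k, x i := by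
      rw [Finset.sum_range_succ]; ring
    rw [h3]
    refine (abs_sub _ _).trans ?_
    nlinarith [(Nat.cast_nonneg k : (0 : ℝ) ≤ k), mul_nonneg hC (Nat.cast_nonneg k : (0 : ℝ) ≤ k)]
  have hbound : ∀ σ : ℝ, 4 ≤ σ → ∀ N, |dirichletPartialSum x σ (N + 1) - x 0| ≤
      2 ^ (-(σ - 4)) * (4 * C * ∑' k : ℕ, ((k : ℝ) + 1) ^ (-(3 : ℝ))) := by
    intro σ hσ N
    rw [dirichletPartialSum, Finset.sum_range_succ']
    simp only [Nat.cast_zero, zero_add, Real.one_rpow, div_one, add_sub_cancel_right]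
    have hs : Summable fun k : ℕ => ((k : ℝ) + 1) ^ (-(3 : ℝ)) := summable_rpow_neg (by norm_num)
    calc |∑ k ∈ Finset.range N, x (k + 1) / (((k + 1 : ℕ) : ℝ) + 1) ^ σ|
        ≤ ∑ k ∈ Finset.range N, |x (k + 1) / (((k + 1 : ℕ) : ℝ) + 1) ^ σ| :=
          Finset.abs_sum_le_sum_abs _ _
      _ ≤ ∑ k ∈ Finset.range N, 2 ^ (-(σ - 4)) * (4 * C * ((k : ℝ) + 1) ^ (-(3 : ℝ))) := by
          refine Finset.sum_le_sum fun k _ => ?_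
          have hk : (0 : ℝ) < ((k + 1 : ℕ) : ℝ) + 1 := by positivity
          rw [abs_div, abs_of_pos (Real.rpow_pos_of_pos hk σ), div_eq_mul_inv, ← Real.rpow_neg hk.le]
          -- One power absorbs the linear bound on the coefficients, three give a convergent sum,
          -- and the remaining `σ - 4` give the decay, since every base is at least `2`.
          have e : -σ = -(σ - 4) + (-3 + -1) := by ring
          rw [e, Real.rpow_add hk, Real.rpow_add hk, Real.rpow_neg_one]
          have h1 : (((k + 1 : ℕ) : ℝ) + 1) ^ (-(σ - 4)) ≤ 2 ^ (-(σ - 4)) := by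
            refine Real.rpow_le_rpow_of_nonpos (by norm_num) ?_ (by linarith)
            push_cast
            linarith [(Nat.cast_nonneg k : (0 : ℝ) ≤ k)]
          have h2 : (((k + 1 : ℕ) : ℝ) + 1) ^ (-3 : ℝ) ≤ ((k : ℝ) + 1) ^ (-3 : ℝ) := by
            refine Real.rpow_le_rpow_of_nonpos (by positivity) ?_ (by linarith)
            push_cast
            linarith
          have h3 : |x (k + 1)| * (((k + 1 : ℕ) : ℝ) + 1)⁻¹ ≤ 4 * C := by
            rw [← div_eq_mul_inv, div_le_iff₀ hk]
            exact hterm (k + 1)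
          calc _ = (((k + 1 : ℕ) : ℝ) + 1) ^ (-(σ - 4)) *
                ((|x (k + 1)| * (((k + 1 : ℕ) : ℝ) + 1)⁻¹) * (((k + 1 : ℕ) : ℝ) + 1) ^ (-3 : ℝ)) := by
                ring
            _ ≤ _ := by gcongr
      _ ≤ _ := by
          rw [← Finset.mul_sum, ← Finset.mul_sum]
          gcongr
          exact hs.sum_le_tsum _ fun k _ => by positivity
  have hlim : ∀ σ : ℝ, 4 ≤ σ → |(dirichletFun x σ).re - x 0| ≤
      2 ^ (-(σ - 4)) * (4 * C * ∑' k : ℕ, ((k : ℝ) + 1) ^ (-(3 : ℝ))) := by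
    intro σ hσ
    have h1 := (tendsto_add_atTop_iff_nat 1).2
      (hx.tendsto_dirichletPartialSum (σ := σ) (by linarith))
    exact le_of_tendsto (h1.sub_const (x 0)).abs (Eventually.of_forall (hbound σ hσ))
  have hz : Tendsto (fun σ : ℝ => (2 : ℝ) ^ (-(σ - 4)) *
      (4 * C * ∑' k : ℕ, ((k : ℝ) + 1) ^ (-(3 : ℝ)))) atTop (𝓝 0) := by
    have h1 : Tendsto (fun σ : ℝ => (2 : ℝ) ^ (-(σ - 4))) atTop (𝓝 0) := by
      have h2 : Tendsto (fun σ : ℝ => -(σ - 4)) atTop atBot :=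
        tendsto_neg_atTop_atBot.comp (tendsto_atTop_add_const_right _ _ tendsto_id)
      have h3 := (Real.tendsto_exp_atBot).comp (h2.const_mul_atBot (Real.log_pos one_lt_two))
      refine h3.congr fun σ => ?_
      simp [Real.rpow_def_of_pos]
    simpa using h1.mul_const (4 * C * ∑' k : ℕ, ((k : ℝ) + 1) ^ (-(3 : ℝ)))
  refine tendsto_iff_norm_sub_tendsto_zero.2 (squeeze_zero' (Eventually.of_forall fun _ => norm_nonneg _) ?_ hz)
  filter_upwards [eventually_ge_atTop 4] with σ hσ
  exact hlim σ hσ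

/-- Zeros stay in a compact interval because the limit at infinity is nonzero. Infinitely many would
accumulate, and the identity theorem would make the function vanish at `A` too. -/
lemma finite_zeros_Ici (hx : SqrtCancellation x) (h0 : x 0 ≠ 0) {T : ℝ} (hT : 1 / 2 < T) :
    {σ : ℝ | T ≤ σ ∧ dirichletFun x σ = 0}.Finite := by
  obtain ⟨A, hA⟩ := ((hx.tendsto_re_dirichletFun_atTop.eventually_ne h0).and
    (eventually_ge_atTop 1)).exists_forall_of_atTop
  have hA' : ∀ σ : ℝ, A ≤ σ → dirichletFun x σ ≠ 0 := fun σ hσ h => (hA σ hσ).1 (by simp [h])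
  by_contra hinf
  have hinf : Set.Infinite {σ : ℝ | T ≤ σ ∧ dirichletFun x σ = 0} := hinf
  obtain ⟨p, hpm, hp⟩ := hinf.exists_accPt_of_subset_isCompact (isCompact_Icc (a := T) (b := A))
    (fun σ hσ => ⟨hσ.1, le_of_not_ge fun h => hA' σ h hσ.2⟩)
  have hopen : IsOpen {z : ℂ | 1 / 2 < z.re} := isOpen_lt continuous_const Complex.continuous_re
  have hconv : Convex ℝ {z : ℂ | 1 / 2 < z.re} := convex_halfSpace_re_gt _
  have hfreq : ∃ᶠ z in 𝓝[≠] (p : ℂ), dirichletFun x z = 0 := by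
    rw [accPt_iff_frequently] at hp
    rw [frequently_nhdsWithin_iff]
    refine Filter.Tendsto.frequently (f := fun σ : ℝ => (σ : ℂ)) (Complex.continuous_ofReal.tendsto p) ?_
    refine hp.mono fun σ hσ => ⟨hσ.2.2, ?_⟩
    simpa using hσ.1
  have hz := (hx.differentiableOn_dirichletFun.analyticOnNhd
    hopen).eqOn_zero_of_preconnected_of_frequently_eq_zero hconv.isPreconnected
    (show (p : ℂ) ∈ {z : ℂ | 1 / 2 < z.re} by simpa using hT.trans_le hpm.1) hfreq
  have h1 := hA A le_rfl
  exact hA' A le_rfl (hz (show ((A : ℝ) : ℂ) ∈ {z : ℂ | 1 / 2 < z.re} by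
    simp; linarith [h1.2]))

end SqrtCancellation

/-! ### Zeros in a disc against size at the centre, in the manner of Jensen. -/

/-- Divide out one zero at a time: `dslope f b` is holomorphic across `b` and still vanishes at the
other points of `Z`. -/
lemma exists_eq_prod_mul_of_zeros {U : Set ℂ} (hU : IsOpen U) (Z : Finset ℂ) :
    ∀ {f : ℂ → ℂ}, DifferentiableOn ℂ f U → (↑Z ⊆ U) → (∀ a ∈ Z, f a = 0) →
      ∃ g : ℂ → ℂ, DifferentiableOn ℂ g U ∧ ∀ z, f z = (∏ a ∈ Z, (z - a)) * g z := by
  classical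
  induction Z using Finset.induction_on with
  | empty => exact fun {f} hf _ _ => ⟨f, hf, fun z => by simp⟩
  | insert b Z hb ih =>
    intro f hf hZ h0
    have hbU : b ∈ U := hZ (by simp)
    have hfac : ∀ z, f z = (z - b) * dslope f b z := by
      intro z
      have h := sub_smul_dslope f b z
      rw [h0 b (by simp), sub_zero, smul_eq_mul] at h
      exact h.symm
    obtain ⟨g, hg, hg'⟩ := ih ((Complex.differentiableOn_dslope (hU.mem_nhds hbU)).2 hf)
      (fun a ha => hZ (by simp [Finset.mem_coe.1 ha]))
      (fun a ha => by
        have hab : a - b ≠ 0 := sub_ne_zero.2 fun h => hb (h ▸ ha)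
        have h := hfac a
        rw [h0 a (by simp [ha])] at h
        exact (mul_eq_zero.1 h.symm).resolve_left hab)
    refine ⟨g, hg, fun z => ?_⟩
    rw [hfac, hg', Finset.prod_insert hb, mul_assoc]

/-- A holomorphic function with many zeros near the centre of a disc is small at the centre,
compared with its mean square on the boundary. -/
lemma norm_sq_center_le_of_zeros {U : Set ℂ} (hU : IsOpen U) {f : ℂ → ℂ}
    (hf : DifferentiableOn ℂ f U) {c : ℂ} {r R : ℝ} (hr : 0 ≤ r) (hrR : r < R)
    (hball : Metric.closedBall c R ⊆ U) (Z : Finset ℂ) (hZ : ∀ a ∈ Z, a ∈ Metric.closedBall c r)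
    (h0 : ∀ a ∈ Z, f a = 0) :
    ‖f c‖ ^ 2 ≤ ((r / (R - r)) ^ 2) ^ Z.card * Real.circleAverage (fun z => ‖f z‖ ^ 2) c R := by
  have hR : 0 < R := hr.trans_lt hrR
  obtain ⟨g, hg, hfg⟩ := exists_eq_prod_mul_of_zeros hU Z hf
    (fun a ha => hball (Metric.closedBall_subset_closedBall hrR.le (hZ a ha))) h0
  have hcirc : ∀ θ, circleMap c R θ ∈ Metric.closedBall c R := fun θ =>
    Metric.sphere_subset_closedBall (circleMap_mem_sphere c hR.le θ)
  have hcont : ∀ {h : ℂ → ℂ}, DifferentiableOn ℂ h U → Continuous fun θ => h (circleMap c R θ) :=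
    fun hh => hh.continuousOn.comp_continuous (continuous_circleMap c R) fun θ => hball (hcirc θ)
  -- The mean value property for the holomorphic `g ^ 2` gives the sub-mean inequality for `‖g‖ ^ 2`
  -- on taking norms.
  have hmean : Real.circleAverage (fun z => g z ^ 2) c R = g c ^ 2 := by
    have hd : DiffContOnCl ℂ (fun z => g z ^ 2) (Metric.ball c |R|) := by
      rw [abs_of_pos hR]
      exact ((hg.pow 2).mono hball).diffContOnCl_ball subset_rfl
    exact hd.circleAverage
  have hg1 : ‖g c‖ ^ 2 ≤ Real.circleAverage (fun z => ‖g z‖ ^ 2) c R := by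
    rw [← norm_pow, ← hmean, Real.circleAverage_def, Real.circleAverage_def, norm_smul, smul_eq_mul,
      Real.norm_of_nonneg (by positivity)]
    gcongr
    refine (intervalIntegral.norm_integral_le_integral_norm Real.two_pi_pos.le).trans (le_of_eq ?_)
    simp only [norm_pow]
  -- On the circle each factor `z - a` has norm at least `R - r`; at the centre it has norm at most
  -- `r`.
  have hg2 : ((R - r) ^ 2) ^ Z.card * Real.circleAverage (fun z => ‖g z‖ ^ 2) c R ≤
      Real.circleAverage (fun z => ‖f z‖ ^ 2) c R := by
    rw [Real.circleAverage_def, Real.circleAverage_def, smul_eq_mul, smul_eq_mul, mul_left_comm]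
    gcongr
    rw [← intervalIntegral.integral_const_mul]
    refine intervalIntegral.integral_mono_on Real.two_pi_pos.le ?_ ?_ fun θ _ => ?_
    · exact (((hcont hg).norm.pow 2).const_mul _).intervalIntegrable _ _
    · exact ((hcont hf).norm.pow 2).intervalIntegrable _ _
    · simp only [hfg (circleMap c R θ), norm_mul, norm_prod, mul_pow]
      gcongr
      rw [← Finset.prod_const, ← Finset.prod_pow, Finset.prod_const, ← Finset.prod_const]
      refine Finset.prod_le_prod (fun _ _ => by positivity) fun a ha => ?_
      have h1 := hZ a ha
      have h2 := circleMap_mem_sphere c hR.le θ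
      rw [Metric.mem_closedBall, dist_eq_norm] at h1
      rw [Metric.mem_sphere, dist_eq_norm] at h2
      have h3 := norm_sub_norm_le (circleMap c R θ - c) (a - c)
      rw [sub_sub_sub_cancel_right] at h3
      have : 0 ≤ R - r := by linarith
      gcongr
      linarith
  have hg3 : ‖f c‖ ^ 2 ≤ (r ^ 2) ^ Z.card * ‖g c‖ ^ 2 := by
    rw [hfg c, norm_mul, norm_prod, mul_pow]
    gcongr
    rw [← Finset.prod_pow, ← Finset.prod_const]
    refine Finset.prod_le_prod (fun _ _ => by positivity) fun a ha => ?_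
    have h1 := hZ a ha
    rw [Metric.mem_closedBall, dist_comm, dist_eq_norm] at h1
    gcongr
  have hpos : 0 < (R - r) ^ 2 := by have : 0 < R - r := by linarith
                                    positivity
  rw [div_pow, div_pow, div_mul_eq_mul_div, le_div_iff₀ (by positivity)]
  calc ‖f c‖ ^ 2 * ((R - r) ^ 2) ^ Z.card
      ≤ (r ^ 2) ^ Z.card * ‖g c‖ ^ 2 * ((R - r) ^ 2) ^ Z.card := by gcongr
    _ ≤ (r ^ 2) ^ Z.card * Real.circleAverage (fun z => ‖g z‖ ^ 2) c R *
          ((R - r) ^ 2) ^ Z.card := by gcongr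
    _ = (r ^ 2) ^ Z.card * (((R - r) ^ 2) ^ Z.card *
          Real.circleAverage (fun z => ‖g z‖ ^ 2) c R) := by ring
    _ ≤ _ := by gcongr

/-! ### Sums of powers, which are the variances of the series. -/

section PowerSums

/-- Comparison of a term of the zeta series with the telescoping differences. -/
lemma rpow_sub_rpow_succ_bounds {t y : ℝ} (ht : 0 < t) (hy : 0 < y) :
    t * (y + 1) ^ (-1 - t) ≤ y ^ (-t) - (y + 1) ^ (-t) ∧
      y ^ (-t) - (y + 1) ^ (-t) ≤ t * y ^ (-1 - t) := by
  obtain ⟨c, ⟨hc1, hc2⟩, hc⟩ := exists_hasDerivAt_eq_slope (fun u : ℝ => u ^ (-t))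
    (fun u => -t * u ^ (-t - 1)) (show y < y + 1 by linarith)
    (fun u hu => (Real.continuousAt_rpow_const u _ (Or.inl (hy.trans_le hu.1).ne')).continuousWithinAt)
    (fun u hu => Real.hasDerivAt_rpow_const (Or.inl (hy.trans hu.1).ne'))
  have hc0 : 0 < c := hy.trans hc1
  have e : y ^ (-t) - (y + 1) ^ (-t) = t * c ^ (-1 - t) := by
    rw [show -1 - t = -t - 1 by ring]
    simp only [add_sub_cancel_left, div_one] at hc
    linarith
  rw [e]
  constructor
  · gcongr ?_ * ?_
    exact Real.rpow_le_rpow_of_nonpos hc0 hc2.le (by linarith)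
  · gcongr ?_ * ?_
    exact Real.rpow_le_rpow_of_nonpos hy hc1.le (by linarith)

lemma sum_Ico_rpow_le {t : ℝ} (ht : 0 < t) {M : ℕ} (hM : 1 ≤ M) (N : ℕ) :
    ∑ k ∈ Finset.Ico M N, ((k : ℝ) + 1) ^ (-1 - t) ≤ (M : ℝ) ^ (-t) / t := by
  rw [le_div_iff₀ ht, Finset.sum_mul]
  have hM0 : (0 : ℝ) < M := by exact_mod_cast hM
  rcases le_total N M with h | h
  · rw [Finset.Ico_eq_empty_of_le h, Finset.sum_empty]; positivity
  calc ∑ k ∈ Finset.Ico M N, ((k : ℝ) + 1) ^ (-1 - t) * t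
      ≤ ∑ k ∈ Finset.Ico M N, ((k : ℝ) ^ (-t) - ((k + 1 : ℕ) : ℝ) ^ (-t)) := by
        refine Finset.sum_le_sum fun k hk => ?_
        have hk0 : (0 : ℝ) < k := by exact_mod_cast hM.trans (Finset.mem_Ico.1 hk).1
        have := (rpow_sub_rpow_succ_bounds ht hk0).1
        push_cast
        linarith
    _ = (M : ℝ) ^ (-t) - (N : ℝ) ^ (-t) := by
        rw [← neg_inj, ← Finset.sum_neg_distrib]
        simp only [neg_sub]
        rw [Finset.sum_Ico_sub (fun k : ℕ => (k : ℝ) ^ (-t)) h]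
    _ ≤ (M : ℝ) ^ (-t) := by
        have : (0 : ℝ) ≤ (N : ℝ) ^ (-t) := by positivity
        linarith

lemma sum_range_rpow_le {t : ℝ} (ht : 0 < t) (N : ℕ) :
    ∑ k ∈ Finset.range N, ((k : ℝ) + 1) ^ (-1 - t) ≤ 1 + 1 / t := by
  rcases Nat.eq_zero_or_pos N with rfl | hN
  · simp; positivity
  rw [Finset.range_eq_Ico, Finset.sum_eq_sum_Ico_succ_bot hN]
  have := sum_Ico_rpow_le ht (le_refl 1) N
  simp at this ⊢
  linarith

lemma eventually_le_sum_range_rpow {t : ℝ} (ht : 0 < t) :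
    ∀ᶠ N : ℕ in atTop, 1 / (2 * t) ≤ ∑ k ∈ Finset.range N, ((k : ℝ) + 1) ^ (-1 - t) := by
  have h1 : Tendsto (fun N : ℕ => ((N : ℝ) + 1) ^ (-t)) atTop (𝓝 0) :=
    (tendsto_rpow_neg_atTop ht).comp
      (tendsto_atTop_add_const_right atTop (1 : ℝ) tendsto_natCast_atTop_atTop)
  filter_upwards [h1.eventually_le_const (show (0 : ℝ) < 1 / 2 by norm_num)] with N hN
  have h2 : 1 - ((N : ℝ) + 1) ^ (-t) ≤ (∑ k ∈ Finset.range N, ((k : ℝ) + 1) ^ (-1 - t)) * t := by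
    rw [Finset.sum_mul]
    calc 1 - ((N : ℝ) + 1) ^ (-t)
        = ∑ k ∈ Finset.range N, (((k : ℝ) + 1) ^ (-t) - (((k + 1 : ℕ) : ℝ) + 1) ^ (-t)) := by
          rw [Finset.sum_range_sub' (fun k : ℕ => ((k : ℝ) + 1) ^ (-t))]
          simp
      _ ≤ _ := by
          refine Finset.sum_le_sum fun k _ => ?_
          have := (rpow_sub_rpow_succ_bounds ht (show (0 : ℝ) < (k : ℝ) + 1 by positivity)).2
          push_cast
          linarith
  rw [div_le_iff₀ (by positivity)]
  nlinarith

/-- Uniform in `t`, unlike the bound `1 + 1 / t`: it shows that an initial segment contributes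
little variance. -/
lemma sum_range_rpow_le_log {t : ℝ} (ht : 0 ≤ t) (N : ℕ) :
    ∑ k ∈ Finset.range N, ((k : ℝ) + 1) ^ (-1 - t) ≤ 1 + Real.log N := by
  have h := harmonic_le_one_add_log N
  refine le_trans ?_ h
  rw [harmonic]
  push_cast
  refine Finset.sum_le_sum fun k _ => ?_
  rw [← Real.rpow_neg_one]
  exact Real.rpow_le_rpow_of_exponent_le (by linarith [(Nat.cast_nonneg k : (0 : ℝ) ≤ k)])
    (by linarith)

end PowerSums

/-! ### Gaussian linear combinations and their almost sure limits. -/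

section GaussianSums

/-- The density is at most `1 / √(2πv) ≤ 1 / (2√v)`, and the interval has length `2δ`. -/
lemma gaussianReal_abs_lt_le {v : NNReal} (hv : v ≠ 0) {δ : ℝ} :
    gaussianReal 0 v {y | |y| < δ} ≤ ENNReal.ofReal (δ / √v) := by
  rcases le_or_gt δ 0 with hδ | hδ
  · have : {y : ℝ | |y| < δ} = ∅ := by
      ext y; simp; exact hδ.trans (abs_nonneg y)
    simp [this]
  have hv0 : (0 : ℝ) < v := by positivity
  rw [gaussianReal_apply 0 hv]
  calc ∫⁻ y in {y | |y| < δ}, gaussianPDF 0 v y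
      ≤ ∫⁻ _ in {y : ℝ | |y| < δ}, ENNReal.ofReal (1 / (2 * √v)) := by
        refine lintegral_mono fun y => ?_
        rw [gaussianPDF]
        refine ENNReal.ofReal_le_ofReal ?_
        rw [gaussianPDFReal, ← one_div]
        have h1 : Real.exp (-(y - 0) ^ 2 / (2 * v)) ≤ 1 := by
          rw [Real.exp_le_one_iff]
          apply div_nonpos_of_nonpos_of_nonneg
          · nlinarith [sq_nonneg (y - 0)]
          · positivity
        have h2 : 2 * √(v : ℝ) ≤ √(2 * Real.pi * v) := by
          refine Real.le_sqrt_of_sq_le ?_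
          rw [mul_pow, Real.sq_sqrt hv0.le]
          nlinarith [Real.pi_gt_three]
        calc 1 / √(2 * Real.pi * v) * Real.exp (-(y - 0) ^ 2 / (2 * v))
            ≤ 1 / √(2 * Real.pi * v) * 1 := by gcongr
          _ ≤ 1 / (2 * √v) := by
              rw [mul_one]
              gcongr
    _ = ENNReal.ofReal (δ / √v) := by
        have : {y : ℝ | |y| < δ} = Set.Ioo (-δ) δ := by
          ext y; simp [abs_lt]
        rw [lintegral_const, Measure.restrict_apply_univ, this, Real.volume_Ioo,
          ← ENNReal.ofReal_mul (by positivity)]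
        congr 1
        field_simp
        ring

lemma lintegral_sq_gaussianReal (v : NNReal) :
    ∫⁻ y, ENNReal.ofReal (y ^ 2) ∂(gaussianReal 0 v) = v := by
  have h1 : MemLp id 2 (gaussianReal 0 v) := memLp_id_gaussianReal 2
  have h2 := variance_eq_sub h1
  rw [variance_id_gaussianReal] at h2
  have h3 : ∫ y, id y ∂(gaussianReal 0 v) = 0 := integral_id_gaussianReal
  rw [← ofReal_integral_eq_lintegral_ofReal]
  · simp only [h3] at h2
    have : ∫ y : ℝ, y ^ 2 ∂(gaussianReal 0 v) = v := by
      rw [h2]; simp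
    rw [this, ENNReal.ofReal_coe_nnreal]
  · exact h1.integrable_sq
  · exact ae_of_all _ fun y => sq_nonneg y

variable {Ω : Type*} [MeasurableSpace Ω] {P : Measure Ω} [IsProbabilityMeasure P]
  {X : ℕ → Ω → ℝ}

lemma hasLaw_linear_combination (hm : ∀ n, Measurable (X n))
    (hlaw : ∀ n, HasLaw (X n) (gaussianReal 0 1) P) (hindep : iIndepFun X P) (a : ℕ → ℝ)
    (s : Finset ℕ) :
    HasLaw (fun ω => ∑ k ∈ s, a k * X k ω) (gaussianReal 0 (∑ k ∈ s, a k ^ 2).toNNReal) P := by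
  refine ⟨(Finset.measurable_sum s fun k _ => (hm k).const_mul (a k)).aemeasurable, ?_⟩
  induction s using Finset.induction_on with
  | empty =>
    simp
  | insert b s hb ih =>
    have hi : iIndepFun (fun k ω => a k * X k ω) P :=
      hindep.comp (fun k y => a k * y) fun k => measurable_const_mul (a k)
    have h1 : IndepFun (fun ω => ∑ k ∈ s, a k * X k ω) (fun ω => a b * X b ω) P := by
      have := hi.indepFun_finsetSum_of_notMem (fun k => (hm k).const_mul (a k)) hb
      convert this using 1
      ext ω; simp
    have h2 := (gaussianReal_const_mul (hlaw b) (a b)).map_eq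
    have h3 := gaussianReal_add_gaussianReal_of_indepFun h1 ih h2
    have e : (fun ω => ∑ k ∈ insert b s, a k * X k ω) =
        (fun ω => ∑ k ∈ s, a k * X k ω) + fun ω => a b * X b ω := by
      ext ω; simp [Finset.sum_insert hb, add_comm]
    rw [e, h3]
    congr 1
    · simp
    · rw [Finset.sum_insert hb, add_comm (a b ^ 2),
        Real.toNNReal_add (Finset.sum_nonneg fun _ _ => sq_nonneg _) (sq_nonneg _)]
      congr 1
      ext
      simp [sq_nonneg]

lemma lintegral_sq_linear_combination (hm : ∀ n, Measurable (X n))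
    (hlaw : ∀ n, HasLaw (X n) (gaussianReal 0 1) P) (hindep : iIndepFun X P) (a : ℕ → ℝ)
    (s : Finset ℕ) :
    ∫⁻ ω, ENNReal.ofReal ((∑ k ∈ s, a k * X k ω) ^ 2) ∂P = ENNReal.ofReal (∑ k ∈ s, a k ^ 2) := by
  rw [(hasLaw_linear_combination hm hlaw hindep a s).lintegral_comp
    (f := fun y => ENNReal.ofReal (y ^ 2)) (by fun_prop), lintegral_sq_gaussianReal]
  rfl

/-- Chebyshev's inequality for a convergent Gaussian series. -/
lemma measure_ge_le_of_tendsto (hm : ∀ n, Measurable (X n))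
    (hlaw : ∀ n, HasLaw (X n) (gaussianReal 0 1) P) (hindep : iIndepFun X P) {a : ℕ → ℝ} {v : ℝ}
    (hv : ∀ N, ∑ k ∈ Finset.range N, a k ^ 2 ≤ v) {Y : Ω → ℝ}
    (hY : ∀ᵐ ω ∂P, Tendsto (fun N => ∑ k ∈ Finset.range N, a k * X k ω) atTop (𝓝 (Y ω)))
    {l : ℝ} (hl : 0 < l) :
    P {ω | l ≤ |Y ω|} ≤ ENNReal.ofReal (v / l ^ 2) := by
  have hmeas : ∀ N, Measurable fun ω => ENNReal.ofReal ((∑ k ∈ Finset.range N, a k * X k ω) ^ 2) :=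
    fun N => ((Finset.measurable_sum _ fun k _ => (hm k).const_mul (a k)).pow_const 2).ennreal_ofReal
  have hYm : AEMeasurable Y P := aemeasurable_of_tendsto_metrizable_ae atTop
    (fun N => (Finset.measurable_sum (Finset.range N)
      fun k _ => (hm k).const_mul (a k)).aemeasurable) hY
  -- Fatou's lemma carries the variance bound to the limit, whose law is never computed.
  have h1 : ∫⁻ ω, ENNReal.ofReal (Y ω ^ 2) ∂P ≤ ENNReal.ofReal v := by
    calc ∫⁻ ω, ENNReal.ofReal (Y ω ^ 2) ∂P
        = ∫⁻ ω, liminf (fun N => ENNReal.ofReal ((∑ k ∈ Finset.range N, a k * X k ω) ^ 2)) atTop ∂P := by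
          refine lintegral_congr_ae ?_
          filter_upwards [hY] with ω hω
          exact (ENNReal.tendsto_ofReal (hω.pow 2)).liminf_eq.symm
      _ ≤ liminf (fun N => ∫⁻ ω, ENNReal.ofReal ((∑ k ∈ Finset.range N, a k * X k ω) ^ 2) ∂P) atTop :=
          lintegral_liminf_le hmeas
      _ ≤ ENNReal.ofReal v := by
          refine liminf_le_of_frequently_le' (Frequently.of_forall fun N => ?_)
          rw [lintegral_sq_linear_combination hm hlaw hindep]
          exact ENNReal.ofReal_le_ofReal (hv N)
  have h2 := meas_ge_le_lintegral_div (μ := P) (f := fun ω => ENNReal.ofReal (Y ω ^ 2))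
    ((hYm.pow_const 2).ennreal_ofReal) (ε := ENNReal.ofReal (l ^ 2))
    (by simp; positivity) ENNReal.ofReal_ne_top
  rw [ENNReal.ofReal_div_of_pos (by positivity)]
  refine le_trans (measure_mono fun ω hω => ?_) (h2.trans (by gcongr))
  have hω : l ≤ |Y ω| := hω
  show ENNReal.ofReal (l ^ 2) ≤ ENNReal.ofReal (Y ω ^ 2)
  rw [← sq_abs (Y ω)]
  gcongr

/-- Small ball estimate for a convergent Gaussian series. -/
lemma measure_abs_lt_le_of_tendsto (hm : ∀ n, Measurable (X n))
    (hlaw : ∀ n, HasLaw (X n) (gaussianReal 0 1) P) (hindep : iIndepFun X P) {a : ℕ → ℝ} {v : ℝ}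
    (hv0 : 0 < v) (hv : ∀ᶠ N in atTop, v ≤ ∑ k ∈ Finset.range N, a k ^ 2) {Y : Ω → ℝ}
    (hY : ∀ᵐ ω ∂P, Tendsto (fun N => ∑ k ∈ Finset.range N, a k * X k ω) atTop (𝓝 (Y ω)))
    (δ : ℝ) :
    P {ω | |Y ω| < δ} ≤ ENNReal.ofReal (δ / √v) := by
  rcases le_or_gt δ 0 with hδ | hδ
  · have : {ω | |Y ω| < δ} = ∅ := by
      ext ω; simp; exact hδ.trans (abs_nonneg _)
    simp [this]
  -- As the inequality is strict, `|Y| < δ` forces it for all late partial sums. Each `S n` lies in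
  -- an event about one Gaussian sum, and `S` increases.
  set S : ℕ → Set Ω := fun n => ⋂ N ≥ n, {ω | |∑ k ∈ Finset.range N, a k * X k ω| < δ} with hS
  have hmono : Monotone S := by
    intro m n hmn
    exact Set.biInter_subset_biInter_left fun N (hN : n ≤ N) => hmn.trans hN
  have hle : P {ω | |Y ω| < δ} ≤ P (⋃ n, S n) := by
    refine measure_mono_ae ?_
    filter_upwards [hY] with ω hω hlt
    have hlt : |Y ω| < δ := hlt
    obtain ⟨n, hn⟩ := eventually_atTop.1 (hω.abs.eventually_lt_const hlt)
    refine Set.mem_iUnion.2 ⟨n, ?_⟩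
    simp only [hS, Set.mem_iInter]
    exact fun N hN => hn N hN
  refine hle.trans ?_
  rw [hmono.measure_iUnion]
  refine iSup_le fun n => ?_
  obtain ⟨n₀, hn₀⟩ := eventually_atTop.1 hv
  set N := max n n₀ with hN
  have hvN := hn₀ N (le_max_right _ _)
  have hpos : 0 < ∑ k ∈ Finset.range N, a k ^ 2 := hv0.trans_le hvN
  have hsub : S n ⊆ {ω | |∑ k ∈ Finset.range N, a k * X k ω| < δ} :=
    Set.biInter_subset_of_mem (show N ≥ n from le_max_left _ _)
  refine (measure_mono hsub).trans ?_
  rw [(hasLaw_linear_combination hm hlaw hindep a (Finset.range N)).measure_eq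
    (p := fun y => |y| < δ) (measurableSet_lt measurable_id.abs measurable_const)]
  refine (gaussianReal_abs_lt_le (Real.toNNReal_pos.2 hpos).ne').trans ?_
  rw [Real.coe_toNNReal _ hpos.le]
  gcongr

end GaussianSums

/-! ### Almost sure cancellation, and size estimates for the random series. -/

lemma gaussianReal_le_abs_le {v : NNReal} (hv : v ≠ 0) {l : ℝ} (hl : 0 ≤ l) :
    gaussianReal 0 v {y | l ≤ |y|} ≤ ENNReal.ofReal (2 * Real.exp (-l ^ 2 / (2 * v))) := by
  have hv0 : (0 : ℝ) < v := by positivity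
  have key : (gaussianReal 0 v).real {y | l ≤ y} ≤ Real.exp (-l ^ 2 / (2 * v)) := by
    -- Chernoff's bound with the optimal parameter `l / v`.
    have h := measure_ge_le_exp_mul_mgf (μ := gaussianReal 0 v) (X := id) (t := l / v) l
      (by positivity) (by simpa using integrable_exp_mul_gaussianReal (μ := 0) (v := v) (l / v))
    rw [mgf_id_gaussianReal] at h
    refine h.trans (le_of_eq ?_)
    rw [← Real.exp_add]
    congr 1
    field_simp
    ring
  have hneg : (gaussianReal 0 v) {y | y ≤ -l} = (gaussianReal 0 v) {y | l ≤ y} := by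
    have h : (gaussianReal 0 v).map (fun x => -x) = gaussianReal 0 v := by
      rw [gaussianReal_map_neg, neg_zero]
    conv_lhs => rw [← h]
    rw [Measure.map_apply measurable_neg (show MeasurableSet {y : ℝ | y ≤ -l} from measurableSet_Iic)]
    congr 1
    ext y
    simp
  have hsub : {y : ℝ | l ≤ |y|} ⊆ {y | l ≤ y} ∪ {y | y ≤ -l} := by
    intro y hy
    rcases le_abs.1 (show l ≤ |y| from hy) with h | h
    · exact Or.inl h
    · exact Or.inr (show y ≤ -l by linarith)
  calc gaussianReal 0 v {y | l ≤ |y|}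
      ≤ gaussianReal 0 v {y | l ≤ y} + gaussianReal 0 v {y | y ≤ -l} :=
        (measure_mono hsub).trans (measure_union_le _ _)
    _ = 2 * gaussianReal 0 v {y | l ≤ y} := by rw [hneg, two_mul]
    _ ≤ 2 * ENNReal.ofReal (Real.exp (-l ^ 2 / (2 * v))) := by
        gcongr
        rw [← ofReal_measureReal]
        exact ENNReal.ofReal_le_ofReal key
    _ = _ := by
        rw [ENNReal.ofReal_mul (by norm_num)]
        simp

/-- The logarithm is absorbed by `N ^ ε`, and the finitely many early partial sums by the constant.
-/
lemma sqrtCancellation_of_eventually_le {x : ℕ → ℝ}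
    (h : ∀ᶠ N : ℕ in atTop, |∑ k ∈ Finset.range N, x k| ≤
      2 * √((N : ℝ) + 1) * (Real.log (N + 2) + 1)) : SqrtCancellation x := by
  intro ε hε
  obtain ⟨n, hn⟩ := eventually_atTop.1 h
  have hsum : 0 ≤ ∑ i ∈ Finset.range n, |∑ k ∈ Finset.range i, x k| :=
    Finset.sum_nonneg fun _ _ => abs_nonneg _
  refine ⟨2 * (2 ^ ε / ε + 1) + ∑ i ∈ Finset.range n, |∑ k ∈ Finset.range i, x k|,
    by positivity, fun N => ?_⟩
  have hN : (1 : ℝ) ≤ (N : ℝ) + 1 := by linarith [(Nat.cast_nonneg N : (0 : ℝ) ≤ N)]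
  have hone : 1 ≤ ((N : ℝ) + 1) ^ (1 / 2 + ε) := Real.one_le_rpow hN (by linarith)
  have hA : 0 ≤ 2 * ((2 : ℝ) ^ ε / ε + 1) := by positivity
  rw [add_mul]
  rcases lt_or_ge N n with hlt | hge
  · have h1 : |∑ k ∈ Finset.range N, x k| ≤ ∑ i ∈ Finset.range n, |∑ k ∈ Finset.range i, x k| :=
      Finset.single_le_sum (f := fun i => |∑ k ∈ Finset.range i, x k|) (fun _ _ => abs_nonneg _)
        (Finset.mem_range.2 hlt)
    nlinarith [mul_nonneg hA (zero_le_one.trans hone), mul_le_mul_of_nonneg_left hone hsum]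
  · refine (hn N hge).trans ?_
    have h1 : Real.log (N + 2) ≤ 2 ^ ε * ((N : ℝ) + 1) ^ ε / ε := by
      refine (Real.log_le_rpow_div (by positivity) hε).trans ?_
      rw [← Real.mul_rpow (by norm_num) (by positivity)]
      gcongr
      linarith
    have h2 : 1 ≤ ((N : ℝ) + 1) ^ ε := Real.one_le_rpow hN hε.le
    have h3 : Real.log (N + 2) + 1 ≤ (2 ^ ε / ε + 1) * ((N : ℝ) + 1) ^ ε := by
      have : 2 ^ ε * ((N : ℝ) + 1) ^ ε / ε = 2 ^ ε / ε * ((N : ℝ) + 1) ^ ε := by ring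
      linarith
    have h4 : 2 * √((N : ℝ) + 1) * (Real.log (N + 2) + 1) ≤
        2 * (2 ^ ε / ε + 1) * ((N : ℝ) + 1) ^ (1 / 2 + ε) := by
      rw [Real.rpow_add (by positivity), ← Real.sqrt_eq_rpow]
      calc _ ≤ 2 * √((N : ℝ) + 1) * ((2 ^ ε / ε + 1) * ((N : ℝ) + 1) ^ ε) := by gcongr
        _ = _ := by ring
    have : 0 ≤ (∑ i ∈ Finset.range n, |∑ k ∈ Finset.range i, x k|) *
        ((N : ℝ) + 1) ^ (1 / 2 + ε) := by positivity
    linarith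

section RandomSeries

variable {Ω : Type*} [MeasurableSpace Ω] {P : Measure Ω} [IsProbabilityMeasure P]
  {X : ℕ → Ω → ℝ}

/-- The `N`-th partial sum has variance `N`, so it exceeds `2√(N + 1) (log (N + 2) + 1)` with
probability at most `2 (N + 1) ^ (-2)`, which is summable. -/
lemma ae_sqrtCancellation (hm : ∀ n, Measurable (X n))
    (hlaw : ∀ n, HasLaw (X n) (gaussianReal 0 1) P) (hindep : iIndepFun X P) :
    ∀ᵐ ω ∂P, SqrtCancellation fun n => X n ω := by
  have hbound : ∀ N : ℕ, P {ω | 2 * √((N : ℝ) + 1) * (Real.log (N + 2) + 1) ≤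
      |∑ k ∈ Finset.range N, X k ω|} ≤ ENNReal.ofReal (2 * ((N : ℝ) + 1) ^ (-2 : ℝ)) := by
    intro N
    have hlog : 0 ≤ Real.log ((N : ℝ) + 2) :=
      Real.log_nonneg (by linarith [(Nat.cast_nonneg N : (0 : ℝ) ≤ N)])
    rcases Nat.eq_zero_or_pos N with rfl | hN
    · have : {ω : Ω | 2 * √(((0 : ℕ) : ℝ) + 1) * (Real.log ((0 : ℕ) + 2) + 1) ≤
          |∑ k ∈ Finset.range 0, X k ω|} = ∅ := by
        ext ω
        simp only [Finset.range_zero, Finset.sum_empty, abs_zero, Set.mem_ofPred_eq,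
          Set.mem_empty_iff_false, iff_false, not_le]
        positivity
      rw [this]
      simp
    have hN0 : (0 : ℝ) < N := by exact_mod_cast hN
    have hl := hasLaw_linear_combination hm hlaw hindep (fun _ => 1) (Finset.range N)
    simp only [one_mul, one_pow, Finset.sum_const, Finset.card_range, nsmul_eq_mul, mul_one] at hl
    rw [hl.measure_eq (p := fun y => 2 * √((N : ℝ) + 1) * (Real.log (N + 2) + 1) ≤ |y|)
      (measurableSet_le measurable_const measurable_id.abs)]
    refine (gaussianReal_le_abs_le (Real.toNNReal_pos.2 hN0).ne' (by positivity)).trans ?_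
    refine ENNReal.ofReal_le_ofReal ?_
    rw [Real.coe_toNNReal _ hN0.le]
    gcongr 2 * ?_
    rw [Real.rpow_def_of_pos (by positivity)]
    refine Real.exp_le_exp.2 ?_
    rw [mul_pow, mul_pow, Real.sq_sqrt (by positivity), div_le_iff₀ (by positivity)]
    have h1 : Real.log ((N : ℝ) + 1) ≤ Real.log (N + 2) :=
      Real.log_le_log (by positivity) (by linarith)
    have h2 : Real.log ((N : ℝ) + 1) ≤ (Real.log (N + 2) + 1) ^ 2 := by nlinarith
    have h0 : 0 ≤ Real.log ((N : ℝ) + 1) := Real.log_nonneg (by linarith)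
    nlinarith
  have hs : Summable fun N : ℕ => 2 * ((N : ℝ) + 1) ^ (-2 : ℝ) :=
    (SqrtCancellation.summable_rpow_neg (by norm_num)).mul_left 2
  have hBC := ae_eventually_notMem (μ := P)
    (s := fun N : ℕ => {ω | 2 * √((N : ℝ) + 1) * (Real.log (N + 2) + 1) ≤
      |∑ k ∈ Finset.range N, X k ω|})
    (ne_top_of_le_ne_top hs.tsum_ofReal_ne_top (ENNReal.tsum_le_tsum hbound))
  filter_upwards [hBC] with ω hω
  refine sqrtCancellation_of_eventually_le ?_
  filter_upwards [hω] with N hN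
  exact le_of_lt (not_le.1 hN)

lemma ae_tendsto_dirichlet (hm : ∀ n, Measurable (X n))
    (hlaw : ∀ n, HasLaw (X n) (gaussianReal 0 1) P) (hindep : iIndepFun X P) {s : ℝ} (hs : 0 < s) :
    ∀ᵐ ω ∂P, Tendsto (fun N => ∑ k ∈ Finset.range N, ((k : ℝ) + 1) ^ (-(1 / 2 + s)) * X k ω) atTop
      (𝓝 (dirichletFun (fun n => X n ω) ((1 / 2 + s : ℝ) : ℂ)).re) := by
  filter_upwards [ae_sqrtCancellation hm hlaw hindep] with ω hω
  refine (hω.tendsto_dirichletPartialSum (show 1 / 2 < 1 / 2 + s by linarith)).congr fun N => ?_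
  refine Finset.sum_congr rfl fun k _ => ?_
  rw [Real.rpow_neg (by positivity), div_eq_inv_mul]

lemma rpow_neg_half_add_sq (s : ℝ) (k : ℕ) :
    (((k : ℝ) + 1) ^ (-(1 / 2 + s))) ^ 2 = ((k : ℝ) + 1) ^ (-1 - 2 * s) := by
  rw [← Real.rpow_natCast, ← Real.rpow_mul (by positivity)]
  congr 1
  push_cast
  ring

/-- Small ball estimate for the random Dirichlet series on the real line. -/
lemma measure_abs_dirichletFun_lt_le (hm : ∀ n, Measurable (X n))
    (hlaw : ∀ n, HasLaw (X n) (gaussianReal 0 1) P) (hindep : iIndepFun X P) {s : ℝ} (hs : 0 < s)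
    (δ : ℝ) :
    P {ω | |(dirichletFun (fun n => X n ω) ((1 / 2 + s : ℝ) : ℂ)).re| < δ / √s} ≤
      ENNReal.ofReal (2 * δ) := by
  -- With variance at least `1 / (4 * s)`, the scale `√s` cancels from the small ball bound.
  have hv : ∀ᶠ N : ℕ in atTop, 1 / (4 * s) ≤
      ∑ k ∈ Finset.range N, (((k : ℝ) + 1) ^ (-(1 / 2 + s))) ^ 2 := by
    filter_upwards [eventually_le_sum_range_rpow (show 0 < 2 * s by linarith)] with N hN
    simp only [rpow_neg_half_add_sq]
    refine le_trans (le_of_eq ?_) hN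
    congr 1
    ring
  refine (measure_abs_lt_le_of_tendsto hm hlaw hindep (by positivity) hv
    (ae_tendsto_dirichlet hm hlaw hindep hs) _).trans (le_of_eq ?_)
  congr 1
  have h1 : √(1 / (4 * s)) = 1 / (2 * √s) := by
    rw [Real.sqrt_div zero_le_one, Real.sqrt_one, Real.sqrt_mul (by norm_num),
      show (4 : ℝ) = 2 ^ 2 by norm_num, Real.sqrt_sq (by norm_num)]
  have h2 : 0 < √s := Real.sqrt_pos.2 hs
  rw [h1]
  field_simp

/-- Real and imaginary parts are real Gaussian combinations; their second moments add up to the sum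
of the squared moduli of the coefficients. -/
lemma lintegral_enorm_sq_complexPartialSum_le (hm : ∀ n, Measurable (X n))
    (hlaw : ∀ n, HasLaw (X n) (gaussianReal 0 1) P) (hindep : iIndepFun X P) {t : ℝ} (ht : 0 < t)
    {z : ℂ} (hz : 1 + t ≤ 2 * z.re) (N : ℕ) :
    ∫⁻ ω, ENNReal.ofReal (‖complexPartialSum (fun n => X n ω) z N‖ ^ 2) ∂P ≤
      ENNReal.ofReal (1 + 1 / t) := by
  have hre : ∀ ω, (complexPartialSum (fun n => X n ω) z N).re =
      ∑ k ∈ Finset.range N, (((k : ℂ) + 1) ^ (-z)).re * X k ω := by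
    intro ω
    rw [complexPartialSum, Complex.re_sum]
    exact Finset.sum_congr rfl fun k _ => by rw [Complex.re_ofReal_mul, mul_comm]
  have him : ∀ ω, (complexPartialSum (fun n => X n ω) z N).im =
      ∑ k ∈ Finset.range N, (((k : ℂ) + 1) ^ (-z)).im * X k ω := by
    intro ω
    rw [complexPartialSum, Complex.im_sum]
    exact Finset.sum_congr rfl fun k _ => by rw [Complex.im_ofReal_mul, mul_comm]
  have hsplit : ∀ ω, ENNReal.ofReal (‖complexPartialSum (fun n => X n ω) z N‖ ^ 2) =
      ENNReal.ofReal ((∑ k ∈ Finset.range N, (((k : ℂ) + 1) ^ (-z)).re * X k ω) ^ 2) +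
      ENNReal.ofReal ((∑ k ∈ Finset.range N, (((k : ℂ) + 1) ^ (-z)).im * X k ω) ^ 2) := by
    intro ω
    rw [← ENNReal.ofReal_add (sq_nonneg _) (sq_nonneg _), ← hre, ← him, Complex.sq_norm,
      Complex.normSq_apply]
    congr 1
    ring
  simp only [hsplit]
  rw [lintegral_add_left, lintegral_sq_linear_combination hm hlaw hindep,
    lintegral_sq_linear_combination hm hlaw hindep,
    ← ENNReal.ofReal_add (Finset.sum_nonneg fun _ _ => sq_nonneg _)
      (Finset.sum_nonneg fun _ _ => sq_nonneg _), ← Finset.sum_add_distrib]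
  · refine ENNReal.ofReal_le_ofReal (le_trans (Finset.sum_le_sum fun k _ => ?_)
      (sum_range_rpow_le ht N))
    have h1 : (((k : ℂ) + 1) ^ (-z)).re ^ 2 + (((k : ℂ) + 1) ^ (-z)).im ^ 2 =
        ‖((k : ℂ) + 1) ^ (-z)‖ ^ 2 := by
      rw [Complex.sq_norm, Complex.normSq_apply]; ring
    rw [h1, norm_natCast_add_one_cpow, ← Real.rpow_natCast, ← Real.rpow_mul (by positivity)]
    refine Real.rpow_le_rpow_of_exponent_le (by linarith [(Nat.cast_nonneg k : (0 : ℝ) ≤ k)]) ?_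
    push_cast
    linarith
  · exact ((Finset.measurable_sum _ fun k _ => (hm k).const_mul _).pow_const 2).ennreal_ofReal

/-- Markov's inequality for the mean square of the random Dirichlet series on a circle. -/
lemma measure_le_circleAverage_le (hm : ∀ n, Measurable (X n))
    (hlaw : ∀ n, HasLaw (X n) (gaussianReal 0 1) P) (hindep : iIndepFun X P) {t : ℝ} (ht : 0 < t)
    {c : ℂ} {R : ℝ} (hR : 0 ≤ R) (hc : 1 + t ≤ 2 * (c.re - R)) {l : ℝ} (hl : 0 < l) :
    P {ω | l ≤ Real.circleAverage (fun z => ‖dirichletFun (fun n => X n ω) z‖ ^ 2) c R} ≤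
      ENNReal.ofReal ((1 + 1 / t) / l) := by
  have hre : ∀ θ, c.re - R ≤ (circleMap c R θ).re := by
    intro θ
    have h := circleMap_mem_sphere c hR θ
    rw [Metric.mem_sphere, dist_eq_norm] at h
    have := (abs_le.1 ((Complex.abs_re_le_norm (circleMap c R θ - c)).trans h.le)).1
    rw [Complex.sub_re] at this
    linarith
  set f : ℕ → Ω → ℝ → ℝ≥0∞ := fun N ω θ =>
    ENNReal.ofReal (‖complexPartialSum (fun n => X n ω) (circleMap c R θ) N‖ ^ 2) with hf
  have hfm : ∀ N, Measurable (Function.uncurry (f N)) := by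
    intro N
    have h1 : Measurable fun p : Ω × ℝ =>
        complexPartialSum (fun n => X n p.1) (circleMap c R p.2) N := by
      unfold complexPartialSum
      refine Finset.measurable_sum _ fun k _ => ?_
      refine (Complex.measurable_ofReal.comp ((hm k).comp measurable_fst)).mul ?_
      have hk : Continuous fun z : ℂ => ((k : ℂ) + 1) ^ (-z) :=
        (differentiable_id.neg.const_cpow
          (Or.inl (by exact_mod_cast Nat.succ_ne_zero k)) : Differentiable ℂ _).continuous
      exact ((hk.comp (continuous_circleMap c R)).measurable).comp measurable_snd
    exact (h1.norm.pow_const 2).ennreal_ofReal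
  -- Defined by a liminf of partial sums, the integrand is jointly measurable, so Tonelli and Fatou
  -- apply; almost surely it is `‖F‖ ^ 2` on the circle.
  set g : Ω → ℝ≥0∞ := fun ω => ∫⁻ θ in Set.Ioc 0 (2 * Real.pi), liminf (fun N => f N ω θ) atTop
    with hg
  have hlm : Measurable (Function.uncurry fun ω θ => liminf (fun N => f N ω θ) atTop) :=
    Measurable.liminf hfm
  have hgm : Measurable g := hlm.lintegral_prod_right'
  have hEg : ∫⁻ ω, g ω ∂P ≤ ENNReal.ofReal (1 + 1 / t) * ENNReal.ofReal (2 * Real.pi) := by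
    rw [hg, lintegral_lintegral_swap hlm.aemeasurable]
    calc ∫⁻ θ in Set.Ioc 0 (2 * Real.pi), ∫⁻ ω, liminf (fun N => f N ω θ) atTop ∂P
        ≤ ∫⁻ _ in Set.Ioc 0 (2 * Real.pi), ENNReal.ofReal (1 + 1 / t) := by
          refine lintegral_mono fun θ => ?_
          have hN : ∀ N, Measurable fun ω => f N ω θ := fun N => (hfm N).of_uncurry_right
          have hle : ∀ N, ∫⁻ ω, f N ω θ ∂P ≤ ENNReal.ofReal (1 + 1 / t) := fun N =>
            lintegral_enorm_sq_complexPartialSum_le hm hlaw hindep ht (by linarith [hre θ]) N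
          exact (lintegral_liminf_le hN).trans
            (liminf_le_of_frequently_le' (Frequently.of_forall hle))
      _ = _ := by simp
  have hsub : P {ω | l ≤ Real.circleAverage (fun z => ‖dirichletFun (fun n => X n ω) z‖ ^ 2) c R} ≤
      P {ω | ENNReal.ofReal (2 * Real.pi * l) ≤ g ω} := by
    refine measure_mono_ae ?_
    filter_upwards [ae_sqrtCancellation hm hlaw hindep] with ω hω hle
    have hle : l ≤ Real.circleAverage (fun z => ‖dirichletFun (fun n => X n ω) z‖ ^ 2) c R := hle
    have hhalf : ∀ θ, 1 / 2 < (circleMap c R θ).re := fun θ => by linarith [hre θ]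
    have hcont : Continuous fun θ => ‖dirichletFun (fun n => X n ω) (circleMap c R θ)‖ ^ 2 :=
      (hω.differentiableOn_dirichletFun.continuousOn.comp_continuous
        (continuous_circleMap c R) hhalf).norm.pow 2
    have hgω : g ω = ENNReal.ofReal (∫ θ in 0..(2 * Real.pi),
        ‖dirichletFun (fun n => X n ω) (circleMap c R θ)‖ ^ 2) := by
      rw [intervalIntegral.integral_of_le Real.two_pi_pos.le, ofReal_integral_eq_lintegral_ofReal]
      · refine lintegral_congr fun θ => ?_
        exact (ENNReal.tendsto_ofReal
          ((hω.tendsto_complexPartialSum (hhalf θ)).norm.pow 2)).liminf_eq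
      · exact (hcont.intervalIntegrable 0 (2 * Real.pi)).1
      · exact ae_of_all _ fun θ => by positivity
    show ENNReal.ofReal (2 * Real.pi * l) ≤ g ω
    rw [hgω]
    refine ENNReal.ofReal_le_ofReal ?_
    rw [Real.circleAverage_def, smul_eq_mul, ← div_eq_inv_mul, le_div_iff₀ Real.two_pi_pos] at hle
    linarith
  refine hsub.trans ?_
  have hpos : 0 < 2 * Real.pi * l := by positivity
  refine (meas_ge_le_lintegral_div hgm.aemeasurable (by simpa using hpos)
    ENNReal.ofReal_ne_top).trans ?_
  refine (ENNReal.div_le_div_right hEg _).trans (le_of_eq ?_)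
  rw [← ENNReal.ofReal_mul (by positivity), ← ENNReal.ofReal_div_of_pos hpos]
  congr 1
  have := Real.pi_pos
  field_simp

end RandomSeries

/-! ### Upper bound: counting zeros on geometric intervals. -/

lemma tendsto_logScale : Tendsto logScale (𝓝[>] (1 / 2 : ℝ)) atTop := by
  have h1 : Tendsto (fun T : ℝ => T - 1 / 2) (𝓝[>] (1 / 2 : ℝ)) (𝓝[>] 0) := by
    refine tendsto_nhdsWithin_iff.2 ⟨?_, ?_⟩
    · have : Tendsto (fun T : ℝ => T - 1 / 2) (𝓝 (1 / 2)) (𝓝 (1 / 2 - 1 / 2)) :=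
        (continuous_id.sub continuous_const).tendsto _
      rw [sub_self] at this
      exact this.mono_left nhdsWithin_le_nhds
    · filter_upwards [self_mem_nhdsWithin] with T hT
      exact sub_pos.2 (show 1 / 2 < T from hT)
  have h2 := Real.tendsto_log_atTop.comp (tendsto_inv_nhdsGT_zero.comp h1)
  refine h2.congr fun T => ?_
  simp [logScale]

lemma exp_neg_logScale {T : ℝ} (hT : 1 / 2 < T) : Real.exp (-logScale T) = T - 1 / 2 := by
  rw [logScale, one_div, Real.log_inv, neg_neg, Real.exp_log (by linarith)]

namespace SqrtCancellation

variable {x : ℕ → ℝ}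

lemma numRealZeros_eq (hx : SqrtCancellation x) (h0 : x 0 ≠ 0) {T : ℝ} (hT : 1 / 2 < T) :
    numRealZeros x T = ({σ : ℝ | T ≤ σ ∧ dirichletFun x σ = 0}.ncard : ℕ∞) := by
  rw [(hx.finite_zeros_Ici h0 hT).cast_ncard_eq, numRealZeros]
  congr 1
  ext σ
  exact and_congr_right fun h => hx.isRealZero_iff (hT.trans_le h)

/-- Zeros near `1 / 2 + s`, in terms of the size of the function at this point and around it. -/
lemma nine_pow_ncard_zeros_le (hx : SqrtCancellation x) (h0 : x 0 ≠ 0) {s : ℝ} (hs : 0 < s)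
    {a b : ℝ} (ha : a ≤ |(dirichletFun x ((1 / 2 + s : ℝ) : ℂ)).re|) (ha0 : 0 ≤ a)
    (hb : Real.circleAverage (fun z => ‖dirichletFun x z‖ ^ 2) ((1 / 2 + s : ℝ) : ℂ) (s / 2) ≤ b) :
    a ^ 2 * 9 ^ {σ : ℝ | (1 / 2 + 7 / 8 * s ≤ σ ∧ σ ≤ 1 / 2 + s) ∧ dirichletFun x σ = 0}.ncard
      ≤ b := by
  have hfin : {σ : ℝ | (1 / 2 + 7 / 8 * s ≤ σ ∧ σ ≤ 1 / 2 + s) ∧ dirichletFun x σ = 0}.Finite :=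
    (hx.finite_zeros_Ici h0 (T := 1 / 2 + 7 / 8 * s) (by linarith)).subset
      fun σ hσ => ⟨hσ.1.1, hσ.2⟩
  have hinj : Function.Injective fun σ : ℝ => (σ : ℂ) := Complex.ofReal_injective
  have hcard := Finset.card_map ⟨_, hinj⟩ (s := hfin.toFinset)
  have h := norm_sq_center_le_of_zeros (isOpen_lt continuous_const Complex.continuous_re)
    hx.differentiableOn_dirichletFun (c := ((1 / 2 + s : ℝ) : ℂ)) (r := s / 8) (R := s / 2)
    (by positivity) (by linarith) (fun z hz => ?_) (hfin.toFinset.map ⟨_, hinj⟩) ?_ ?_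
  · rw [hcard, ← Set.ncard_eq_toFinset_card _ hfin] at h
    -- Radii `s / 8` and `s / 2` give the ratio `1 / 3`, hence the base `9`.
    have e : (s / 8 / (s / 2 - s / 8)) ^ 2 = 9⁻¹ := by field_simp; norm_num
    have h1 : a ^ 2 ≤ ‖dirichletFun x ((1 / 2 + s : ℝ) : ℂ)‖ ^ 2 := by
      have := ha.trans (Complex.abs_re_le_norm _)
      gcongr
    rw [e, inv_pow, inv_mul_eq_div] at h
    exact ((le_div_iff₀ (by positivity)).1 (h1.trans h)).trans hb
  · rw [Metric.mem_closedBall, dist_eq_norm] at hz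
    have := (abs_le.1 ((Complex.abs_re_le_norm _).trans hz)).1
    rw [Complex.sub_re, Complex.ofReal_re] at this
    show 1 / 2 < z.re
    linarith
  · intro z hz
    obtain ⟨σ, hσ, rfl⟩ := Finset.mem_map.1 hz
    have hσ := (hfin.mem_toFinset.1 hσ).1
    rw [Metric.mem_closedBall, Function.Embedding.coeFn_mk, Complex.dist_of_im_eq (by simp), Real.dist_eq, abs_le]
    simp only [Complex.ofReal_re]
    constructor <;> linarith
  · intro z hz
    obtain ⟨σ, hσ, rfl⟩ := Finset.mem_map.1 hz
    exact (hfin.mem_toFinset.1 hσ).2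

lemma limsup_numRealZeros_lt_top (hx : SqrtCancellation x) (h0 : x 0 ≠ 0)
    (hlow : ∀ᶠ k : ℕ in atTop, 1 / ((k : ℝ) + 1) ^ 2 / √((7 / 8) ^ k) ≤
      |(dirichletFun x ((1 / 2 + (7 / 8) ^ k : ℝ) : ℂ)).re|)
    (hup : ∀ᶠ k : ℕ in atTop, Real.circleAverage (fun z => ‖dirichletFun x z‖ ^ 2)
      ((1 / 2 + (7 / 8) ^ k : ℝ) : ℂ) ((7 / 8) ^ k / 2) ≤
        (1 + 1 / (7 / 8) ^ k) * ((k : ℝ) + 1) ^ 2) :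
    limsup (fun T : ℝ => (numRealZeros x T : ℝ≥0∞) /
        ENNReal.ofReal (logScale T * Real.log (logScale T))) (𝓝[>] (1 / 2 : ℝ)) < ⊤ := by
  obtain ⟨k₀, hk₀⟩ := eventually_atTop.1 (hlow.and hup)
  have hstep : ∀ k ≥ k₀, ({σ : ℝ | (1 / 2 + 7 / 8 * (7 / 8) ^ k ≤ σ ∧ σ ≤ 1 / 2 + (7 / 8) ^ k) ∧
      dirichletFun x σ = 0}.ncard : ℝ) ≤ 1 + 3 * Real.log (k + 1) := by
    intro k hk
    have hs : (0 : ℝ) < (7 / 8) ^ k := by positivity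
    have hs1 : ((7 : ℝ) / 8) ^ k ≤ 1 := pow_le_one₀ (by norm_num) (by norm_num)
    have h := hx.nine_pow_ncard_zeros_le h0 hs (hk₀ k hk).1 (by positivity) (hk₀ k hk).2
    set m := {σ : ℝ | (1 / 2 + 7 / 8 * (7 / 8) ^ k ≤ σ ∧ σ ≤ 1 / 2 + (7 / 8) ^ k) ∧
      dirichletFun x σ = 0}.ncard
    set s : ℝ := (7 / 8) ^ k
    have hk1 : (0 : ℝ) < (k : ℝ) + 1 := by positivity
    -- The factors `1 / s` in the upper and lower bounds cancel, leaving only a power of `k + 1`.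
    have h2 : (9 : ℝ) ^ m ≤ 2 * ((k : ℝ) + 1) ^ 6 := by
      rw [div_pow, Real.sq_sqrt hs.le, div_pow, one_pow, div_div, div_mul_eq_mul_div, one_mul,
        div_le_iff₀ (by positivity)] at h
      calc (9 : ℝ) ^ m ≤ (1 + 1 / s) * ((k : ℝ) + 1) ^ 2 * ((((k : ℝ) + 1) ^ 2) ^ 2 * s) := h
        _ = (s + 1) * ((k : ℝ) + 1) ^ 6 := by field_simp
        _ ≤ _ := by gcongr; linarith
    have h3 := Real.log_le_log (by positivity) h2
    rw [Real.log_pow, Real.log_mul (by norm_num) (by positivity), Real.log_pow] at h3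
    have h9 : 2 ≤ Real.log 9 := by
      rw [show (9 : ℝ) = 3 ^ 2 by norm_num, Real.log_pow]
      have : 1 ≤ Real.log 3 := by
        rw [Real.le_log_iff_exp_le (by norm_num)]
        linarith [Real.exp_one_lt_d9]
      push_cast
      linarith
    have hl2 : Real.log 2 ≤ 1 := by linarith [Real.log_two_lt_d9]
    have hm0 : (0 : ℝ) ≤ m := Nat.cast_nonneg m
    push_cast at h3
    nlinarith
  have hfin : ∀ K : ℕ, {σ : ℝ | 1 / 2 + (7 / 8) ^ K ≤ σ ∧ dirichletFun x σ = 0}.Finite := fun K =>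
    hx.finite_zeros_Ici h0 (by linarith [show (0 : ℝ) < (7 / 8) ^ K by positivity])
  set N₀ : ℝ := ({σ : ℝ | 1 / 2 + (7 / 8) ^ k₀ ≤ σ ∧ dirichletFun x σ = 0}.ncard : ℝ) with hN₀
  have hcount : ∀ K ≥ k₀, ({σ : ℝ | 1 / 2 + (7 / 8) ^ K ≤ σ ∧ dirichletFun x σ = 0}.ncard : ℝ) ≤
      N₀ + K * (1 + 3 * Real.log (K + 1)) := by
    intro K hK
    induction K, hK using Nat.le_induction with
    | base =>
      have : 0 ≤ Real.log ((k₀ : ℝ) + 1) :=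
        Real.log_nonneg (by linarith [(Nat.cast_nonneg k₀ : (0 : ℝ) ≤ k₀)])
      have : 0 ≤ (k₀ : ℝ) * (1 + 3 * Real.log (k₀ + 1)) := by positivity
      linarith
    | succ K hK ih =>
      have hsub : {σ : ℝ | 1 / 2 + (7 / 8) ^ (K + 1) ≤ σ ∧ dirichletFun x σ = 0} ⊆
          {σ : ℝ | 1 / 2 + (7 / 8) ^ K ≤ σ ∧ dirichletFun x σ = 0} ∪
          {σ : ℝ | (1 / 2 + 7 / 8 * (7 / 8) ^ K ≤ σ ∧ σ ≤ 1 / 2 + (7 / 8) ^ K) ∧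
            dirichletFun x σ = 0} := by
        rintro σ ⟨hσ, hz⟩
        rcases le_total (1 / 2 + (7 / 8) ^ K) σ with h | h
        · exact Or.inl ⟨h, hz⟩
        · refine Or.inr ⟨⟨?_, h⟩, hz⟩
          rw [pow_succ'] at hσ
          exact hσ
      have hc := (Set.ncard_le_ncard hsub ((hfin K).union
        ((hfin (K + 1)).subset fun σ hσ => ⟨by rw [pow_succ']; exact hσ.1.1, hσ.2⟩))).trans
        (Set.ncard_union_le _ _)
      have hc : ({σ : ℝ | 1 / 2 + (7 / 8) ^ (K + 1) ≤ σ ∧ dirichletFun x σ = 0}.ncard : ℝ) ≤ _ :=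
        (Nat.cast_le (α := ℝ)).2 hc
      push_cast at hc ⊢
      have h1 := hstep K hK
      have h2 : Real.log ((K : ℝ) + 1) ≤ Real.log ((K : ℝ) + 1 + 1) :=
        Real.log_le_log (by positivity) (by linarith)
      have h3 := mul_le_mul_of_nonneg_left h2 (Nat.cast_nonneg K : (0 : ℝ) ≤ K)
      linarith
  have hev : ∀ᶠ T in 𝓝[>] (1 / 2 : ℝ), (numRealZeros x T : ℝ≥0∞) /
      ENNReal.ofReal (logScale T * Real.log (logScale T)) ≤ 64 := by
    filter_upwards [self_mem_nhdsWithin, tendsto_logScale.eventually_ge_atTop 10,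
      tendsto_logScale.eventually_ge_atTop (k₀ : ℝ), tendsto_logScale.eventually_ge_atTop N₀]
      with T hT hL10 hLk hLN
    have hT : 1 / 2 < T := hT
    set L := logScale T with hL
    -- Since `7 / 8 ≤ exp (-1 / 8)`, this `K` gives `(7 / 8) ^ K ≤ exp (-L) = T - 1 / 2`.
    set K := ⌈8 * L⌉₊ with hK
    have hKL : 8 * L ≤ K := Nat.le_ceil _
    have hKL2 : (K : ℝ) ≤ 9 * L := by
      have := Nat.ceil_lt_add_one (show 0 ≤ 8 * L by linarith)
      linarith
    have hKk : k₀ ≤ K := by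
      have : (k₀ : ℝ) ≤ K := by linarith
      exact_mod_cast this
    have hKT : 1 / 2 + (7 / 8) ^ K ≤ T := by
      have h1 : (7 / 8 : ℝ) ≤ Real.exp (-(1 / 8)) := by
        have := Real.add_one_le_exp (-(1 / 8 : ℝ)); linarith
      have h2 : (7 / 8 : ℝ) ^ K ≤ Real.exp (-L) := by
        refine (pow_le_pow_left₀ (by norm_num) h1 K).trans ?_
        rw [← Real.exp_nat_mul]
        exact Real.exp_le_exp.2 (by linarith)
      rw [exp_neg_logScale hT] at h2
      linarith
    have hlogL : 1 ≤ Real.log L := by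
      rw [Real.le_log_iff_exp_le (by linarith)]
      linarith [Real.exp_one_lt_d9]
    have hlogK : Real.log ((K : ℝ) + 1) ≤ 2 * Real.log L := by
      have h1 := Real.log_le_log (by positivity) (show (K : ℝ) + 1 ≤ L ^ 2 by nlinarith)
      rw [Real.log_pow] at h1
      exact_mod_cast h1
    -- The constant is `9 * 7 + 1`, from `K ≤ 9L`, `1 + 3 log (K + 1) ≤ 7 log L` and `N₀ ≤ L`.
    have hn : ({σ : ℝ | T ≤ σ ∧ dirichletFun x σ = 0}.ncard : ℝ) ≤ 64 * (L * Real.log L) := by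
      have hsub : {σ : ℝ | T ≤ σ ∧ dirichletFun x σ = 0} ⊆
          {σ : ℝ | 1 / 2 + (7 / 8) ^ K ≤ σ ∧ dirichletFun x σ = 0} :=
        fun σ hσ => ⟨hKT.trans hσ.1, hσ.2⟩
      have h1 : ({σ : ℝ | T ≤ σ ∧ dirichletFun x σ = 0}.ncard : ℝ) ≤ _ :=
        (Nat.cast_le (α := ℝ)).2 (Set.ncard_le_ncard hsub (hfin K))
      have h2 := hcount K hKk
      have h3 : (K : ℝ) * (1 + 3 * Real.log (K + 1)) ≤ 9 * L * (7 * Real.log L) := by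
        have : 0 ≤ Real.log ((K : ℝ) + 1) := Real.log_nonneg (by
          linarith [(Nat.cast_nonneg K : (0 : ℝ) ≤ K)])
        gcongr
        linarith
      nlinarith
    refine ENNReal.div_le_of_le_mul ?_
    rw [hx.numRealZeros_eq h0 hT]
    calc (((({σ : ℝ | T ≤ σ ∧ dirichletFun x σ = 0}.ncard : ℕ) : ℕ∞)) : ℝ≥0∞)
        = ENNReal.ofReal ({σ : ℝ | T ≤ σ ∧ dirichletFun x σ = 0}.ncard : ℝ) := by simp
      _ ≤ ENNReal.ofReal (64 * (L * Real.log L)) := ENNReal.ofReal_le_ofReal hn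
      _ = _ := by rw [ENNReal.ofReal_mul (by norm_num)]; simp
  exact (limsup_le_of_le (h := hev)).trans_lt (by simp)

end SqrtCancellation

section UpperBound

variable {Ω : Type*} [MeasurableSpace Ω] {P : Measure Ω} [IsProbabilityMeasure P]
  {X : ℕ → Ω → ℝ}

/-- Both failure probabilities are `O((k + 1) ^ (-2))`, so Borel–Cantelli applies. A nonzero first
coefficient is needed for finiteness of the zeros. -/
lemma ae_limsup_numRealZeros_lt_top (hm : ∀ n, Measurable (X n))
    (hlaw : ∀ n, HasLaw (X n) (gaussianReal 0 1) P) (hindep : iIndepFun X P) :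
    ∀ᵐ ω ∂P, limsup (fun T : ℝ => (numRealZeros (fun n => X n ω) T : ℝ≥0∞) /
        ENNReal.ofReal (logScale T * Real.log (logScale T))) (𝓝[>] (1 / 2 : ℝ)) < ⊤ := by
  have hsum : Summable fun k : ℕ => ((k : ℝ) + 1) ^ (-2 : ℝ) :=
    SqrtCancellation.summable_rpow_neg (by norm_num)
  have hsq : ∀ k : ℕ, 1 / ((k : ℝ) + 1) ^ 2 = ((k : ℝ) + 1) ^ (-2 : ℝ) := by
    intro k
    rw [Real.rpow_neg (by positivity), one_div]
    norm_cast
  have hlow := ae_eventually_notMem (μ := P)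
    (s := fun k : ℕ => {ω | |(dirichletFun (fun n => X n ω) ((1 / 2 + (7 / 8) ^ k : ℝ) : ℂ)).re| <
      1 / ((k : ℝ) + 1) ^ 2 / √((7 / 8) ^ k)})
    (ne_top_of_le_ne_top (hsum.mul_left 2).tsum_ofReal_ne_top (ENNReal.tsum_le_tsum fun k => by
      rw [← hsq k]
      exact measure_abs_dirichletFun_lt_le hm hlaw hindep (by positivity) _))
  have hup := ae_eventually_notMem (μ := P)
    (s := fun k : ℕ => {ω | (1 + 1 / (7 / 8) ^ k) * ((k : ℝ) + 1) ^ 2 ≤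
      Real.circleAverage (fun z => ‖dirichletFun (fun n => X n ω) z‖ ^ 2)
        ((1 / 2 + (7 / 8) ^ k : ℝ) : ℂ) ((7 / 8) ^ k / 2)})
    (ne_top_of_le_ne_top hsum.tsum_ofReal_ne_top (ENNReal.tsum_le_tsum fun k => by
      have hs : (0 : ℝ) < (7 / 8) ^ k := by positivity
      refine (measure_le_circleAverage_le hm hlaw hindep hs (by positivity) ?_
        (by positivity)).trans (le_of_eq ?_)
      · rw [Complex.ofReal_re]; linarith
      · rw [← hsq k]
        congr 1
        field_simp))
  have h0 : ∀ᵐ ω ∂P, X 0 ω ≠ 0 := by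
    have h := (hlaw 0).ae_iff (p := fun y => y ≠ 0) (measurableSet_eq.compl.mem)
    rw [h]
    have : NullSingletonClass (gaussianReal 0 1) := nullSingletonClass_gaussianReal one_ne_zero
    exact compl_mem_ae_iff.2 (measure_singleton 0)
  filter_upwards [ae_sqrtCancellation hm hlaw hindep, hlow, hup, h0] with ω hω h1 h2 h3
  refine hω.limsup_numRealZeros_lt_top h3 (h1.mono fun k hk => not_lt.1 hk)
    (h2.mono fun k hk => (not_le.1 hk).le)

end UpperBound

/-! ### Lower bound: sample points and nearly independent signs. -/

/-- The distances to `1 / 2` of the points at which signs are observed. -/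
noncomputable def sampleOffset (j : ℕ) : ℝ := Real.exp (-((j : ℝ) + 1) ^ 2)

/-- The ends of the blocks of coefficients which determine the signs at the sample points. -/
noncomputable def blockStart (j : ℕ) : ℕ := ⌈Real.exp (Real.exp ((j : ℝ) * (j + 1)))⌉₊

/-- The block of indices that dominates the series at the `j`-th sample point. -/
noncomputable def block (j : ℕ) : Finset ℕ := Finset.Ico (blockStart j) (blockStart (j + 1))

/-- The contribution of the `j`-th block to the series at the `j`-th sample point. -/
noncomputable def blockSum (x : ℕ → ℝ) (j : ℕ) : ℝ :=
  ∑ k ∈ block j, ((k : ℝ) + 1) ^ (-(1 / 2 + sampleOffset j)) * x k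

lemma sampleOffset_pos (j : ℕ) : 0 < sampleOffset j := Real.exp_pos _

lemma sampleOffset_strictAnti : StrictAnti sampleOffset := by
  refine strictAnti_nat_of_succ_lt fun j => Real.exp_lt_exp.2 ?_
  push_cast
  nlinarith [(Nat.cast_nonneg j : (0 : ℝ) ≤ j)]

lemma blockStart_strictMono : StrictMono blockStart := by
  refine strictMono_nat_of_lt_succ fun j => ?_
  refine Nat.lt_ceil.2 ?_
  have hj : (0 : ℝ) ≤ j := Nat.cast_nonneg j
  refine (Nat.ceil_lt_add_one (Real.exp_pos _).le).trans_le ?_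
  set a := Real.exp ((j : ℝ) * (j + 1)) with ha
  set b := Real.exp (((j + 1 : ℕ) : ℝ) * ((j + 1 : ℕ) + 1)) with hb
  have h1 : a + 1 ≤ b := by
    have h2 : b = a * Real.exp (2 * (j + 1)) := by
      rw [ha, hb, ← Real.exp_add]
      congr 1
      push_cast
      ring
    have h3 : 2 * ((j : ℝ) + 1) + 1 ≤ Real.exp (2 * (j + 1)) := Real.add_one_le_exp _
    have h4 : 1 ≤ a := Real.one_le_exp (by positivity)
    rw [h2]
    nlinarith
  calc Real.exp a + 1 ≤ Real.exp a * Real.exp 1 := by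
        have h5 : 1 ≤ Real.exp a := Real.one_le_exp (Real.exp_pos _).le
        nlinarith [Real.add_one_le_exp (1 : ℝ)]
    _ = Real.exp (a + 1) := (Real.exp_add a 1).symm
    _ ≤ Real.exp b := Real.exp_le_exp.2 h1

lemma one_le_blockStart (j : ℕ) : 1 ≤ blockStart j := Nat.one_le_ceil_iff.2 (Real.exp_pos _)

/-- The total variance is of order `1 / s`. Terms before the block contribute about the logarithm of
its start, `exp (j * (j + 1)) = exp (-(j + 1)) / s`. Those after it carry a factor at most `exp (-2
* exp (j + 1))`. -/
lemma sum_rpow_off_block_le (j N : ℕ) :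
    ∑ k ∈ Finset.range N, (if k ∈ block j then 0 else
      ((k : ℝ) + 1) ^ (-(1 / 2 + sampleOffset j))) ^ 2 ≤
      4 * Real.exp (-((j : ℝ) + 1)) / sampleOffset j := by
  set s := sampleOffset j with hs
  have hs0 : 0 < s := sampleOffset_pos j
  have hj : (0 : ℝ) ≤ j := Nat.cast_nonneg j
  have hexp : Real.exp (-((j : ℝ) + 1)) / s = Real.exp (j * (j + 1)) := by
    rw [hs, sampleOffset, ← Real.exp_sub]
    congr 1
    ring
  have hlow : ∑ k ∈ Finset.range (blockStart j), ((k : ℝ) + 1) ^ (-1 - 2 * s) ≤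
      3 * (Real.exp (-((j : ℝ) + 1)) / s) := by
    refine (sum_range_rpow_le_log (by positivity) _).trans ?_
    rw [hexp]
    set a := Real.exp ((j : ℝ) * (j + 1)) with ha
    have h4 : 1 ≤ a := Real.one_le_exp (by positivity)
    have h5 : Real.log (blockStart j) ≤ a + 1 := by
      rw [Real.log_le_iff_le_exp (by exact_mod_cast one_le_blockStart j)]
      refine (Nat.ceil_lt_add_one (Real.exp_pos _).le).le.trans ?_
      rw [Real.exp_add]
      have h5 : 1 ≤ Real.exp a := Real.one_le_exp (Real.exp_pos _).le
      nlinarith [Real.add_one_le_exp (1 : ℝ)]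
    linarith
  have hhigh : ∑ k ∈ Finset.Ico (blockStart (j + 1)) N, ((k : ℝ) + 1) ^ (-1 - 2 * s) ≤
      Real.exp (-((j : ℝ) + 1)) / s := by
    refine (sum_Ico_rpow_le (t := 2 * s) (by positivity) (one_le_blockStart _) N).trans ?_
    have h1 : (blockStart (j + 1) : ℝ) ^ (-(2 * s)) ≤ Real.exp (-((j : ℝ) + 1)) := by
      have h2 : Real.exp (Real.exp (((j + 1 : ℕ) : ℝ) * ((j + 1 : ℕ) + 1))) ≤ blockStart (j + 1) :=
        Nat.le_ceil _
      refine (Real.rpow_le_rpow_of_nonpos (Real.exp_pos _) h2 (by linarith)).trans ?_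
      rw [← Real.exp_mul]
      refine Real.exp_le_exp.2 ?_
      have h3 : Real.exp (((j + 1 : ℕ) : ℝ) * ((j + 1 : ℕ) + 1)) * s = Real.exp (j + 1) := by
        rw [hs, sampleOffset, ← Real.exp_add]
        congr 1
        push_cast
        ring
      have h4 := Real.add_one_le_exp ((j : ℝ) + 1)
      nlinarith
    calc (blockStart (j + 1) : ℝ) ^ (-(2 * s)) / (2 * s)
        ≤ Real.exp (-((j : ℝ) + 1)) / (2 * s) := by gcongr
      _ ≤ Real.exp (-((j : ℝ) + 1)) / s := by gcongr; linarith
  have hterm : ∀ k : ℕ, (if k ∈ block j then 0 else ((k : ℝ) + 1) ^ (-(1 / 2 + s))) ^ 2 =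
      if k ∉ block j then ((k : ℝ) + 1) ^ (-1 - 2 * s) else 0 := by
    intro k
    rw [ite_not]
    split_ifs
    · norm_num
    · exact rpow_neg_half_add_sq s k
  simp only [hterm]
  rw [← Finset.sum_filter]
  have hsub : (Finset.range N).filter (fun k => k ∉ block j) ⊆
      Finset.range (blockStart j) ∪ Finset.Ico (blockStart (j + 1)) N := by
    intro k hk
    simp only [block, Finset.mem_filter, Finset.mem_range, Finset.mem_Ico, Finset.mem_union] at hk ⊢
    omega
  calc _ ≤ ∑ k ∈ Finset.range (blockStart j) ∪ Finset.Ico (blockStart (j + 1)) N,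
          ((k : ℝ) + 1) ^ (-1 - 2 * s) :=
        Finset.sum_le_sum_of_subset_of_nonneg hsub fun _ _ _ => by positivity
    _ ≤ _ := by
        rw [Finset.sum_union]
        · calc _ ≤ 3 * (Real.exp (-((j : ℝ) + 1)) / s) + Real.exp (-((j : ℝ) + 1)) / s :=
              add_le_add hlow hhigh
            _ = _ := by ring
        · rw [Finset.disjoint_left]
          intro k hk hk'
          have := blockStart_strictMono (Nat.lt_succ_self j)
          simp only [Finset.mem_range, Finset.mem_Ico] at hk hk'
          simp only [Nat.succ_eq_add_one] at this
          omega

lemma disjoint_block {i j : ℕ} (h : i < j) : Disjoint (block i) (block j) := by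
  rw [Finset.disjoint_left]
  intro k hk hk'
  have := blockStart_strictMono.monotone (Nat.succ_le_of_lt h)
  simp only [block, Finset.mem_Ico, Nat.succ_eq_add_one] at hk hk' this
  omega

/-- Stated for pairs of sums so as to separate both two single blocks (second coefficients zero) and
two pairs of blocks. -/
lemma indepFun_linear_combinations {Ω : Type*} [MeasurableSpace Ω] {P : Measure Ω}
    {X : ℕ → Ω → ℝ} (hm : ∀ n, Measurable (X n)) (hindep : iIndepFun X P)
    {S T : Finset ℕ} (hST : Disjoint S T) (a b a' b' : ℕ → ℝ) :
    IndepFun (fun ω => (∑ k ∈ S, a k * X k ω, ∑ k ∈ S, b k * X k ω))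
      (fun ω => (∑ k ∈ T, a' k * X k ω, ∑ k ∈ T, b' k * X k ω)) P := by
  have h := hindep.indepFun_finset S T hST hm
  have hφ : ∀ (S : Finset ℕ) (a b : ℕ → ℝ), Measurable fun y : S → ℝ =>
      (∑ k : S, a k * y k, ∑ k : S, b k * y k) := by
    intro S a b
    fun_prop
  have h2 := h.comp (hφ S a b) (hφ T a' b')
  convert h2 using 1
  · ext ω
    · exact (Finset.sum_coe_sort S fun k => a k * X k ω).symm
    · exact (Finset.sum_coe_sort S fun k => b k * X k ω).symm
  · ext ω
    · exact (Finset.sum_coe_sort T fun k => a' k * X k ω).symm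
    · exact (Finset.sum_coe_sort T fun k => b' k * X k ω).symm

section Probability

variable {Ω : Type*} [MeasurableSpace Ω] {P : Measure Ω} [IsProbabilityMeasure P]
  {X : ℕ → Ω → ℝ}

/-- Almost surely, the signs at the sample points are eventually those of the blocks. -/
lemma ae_eventually_sign_eq (hm : ∀ n, Measurable (X n))
    (hlaw : ∀ n, HasLaw (X n) (gaussianReal 0 1) P) (hindep : iIndepFun X P) :
    ∀ᵐ ω ∂P, ∀ᶠ j in atTop,
      (0 < blockSum (fun n => X n ω) j →
        0 < (dirichletFun (fun n => X n ω) ((1 / 2 + sampleOffset j : ℝ) : ℂ)).re) ∧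
      (blockSum (fun n => X n ω) j < 0 →
        (dirichletFun (fun n => X n ω) ((1 / 2 + sampleOffset j : ℝ) : ℂ)).re < 0) := by
  -- The exponent `1 / 4` balances two summable bounds: `2 * δ j` for the small ball, and `4 * exp
  -- (-(j + 1)) / δ j ^ 2` for the off-block part.
  set δ : ℕ → ℝ := fun j => Real.exp (-((j : ℝ) + 1) / 4) with hδ
  have hδ0 : ∀ j, 0 < δ j := fun j => Real.exp_pos _
  have hexp : ∀ c : ℝ, 0 < c → Summable fun j : ℕ => Real.exp (-((j : ℝ) + 1) * c) := by
    intro c hc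
    have h := (Real.summable_exp_nat_mul_iff.2 (show -c < 0 by linarith)).mul_left (Real.exp (-c))
    refine h.congr fun j => ?_
    rw [← Real.exp_add]
    congr 1
    ring
  have hs1 : Summable fun j => 2 * δ j := ((hexp (1 / 4) (by norm_num)).congr fun j => by
    rw [hδ]; congr 1; ring).mul_left 2
  have hs2 : Summable fun j : ℕ => 4 * Real.exp (-((j : ℝ) + 1) * (1 / 2)) :=
    (hexp (1 / 2) (by norm_num)).mul_left 4
  have h1 := ae_eventually_notMem (μ := P)
    (s := fun j : ℕ => {ω | |(dirichletFun (fun n => X n ω)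
      ((1 / 2 + sampleOffset j : ℝ) : ℂ)).re| < δ j / √(sampleOffset j)})
    (ne_top_of_le_ne_top hs1.tsum_ofReal_ne_top (ENNReal.tsum_le_tsum fun j =>
      measure_abs_dirichletFun_lt_le hm hlaw hindep (sampleOffset_pos j) _))
  have h2 := ae_eventually_notMem (μ := P)
    (s := fun j : ℕ => {ω | δ j / √(sampleOffset j) ≤ |(dirichletFun (fun n => X n ω)
      ((1 / 2 + sampleOffset j : ℝ) : ℂ)).re - blockSum (fun n => X n ω) j|})
    (ne_top_of_le_ne_top hs2.tsum_ofReal_ne_top (ENNReal.tsum_le_tsum fun j => by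
      have hs := sampleOffset_pos j
      refine (measure_ge_le_of_tendsto hm hlaw hindep (sum_rpow_off_block_le j) ?_
        (div_pos (hδ0 j) (Real.sqrt_pos.2 hs))).trans (le_of_eq ?_)
      · filter_upwards [ae_tendsto_dirichlet hm hlaw hindep hs] with ω hω
        refine (hω.sub_const (blockSum (fun n => X n ω) j)).congr' ?_
        filter_upwards [eventually_ge_atTop (blockStart (j + 1))] with N hN
        have hsub : block j ⊆ Finset.range N := by
          intro k hk
          simp only [block, Finset.mem_Ico] at hk
          exact Finset.mem_range.2 (hk.2.trans_le hN)
        have e : blockSum (fun n => X n ω) j = ∑ k ∈ Finset.range N, if k ∈ block j then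
            ((k : ℝ) + 1) ^ (-(1 / 2 + sampleOffset j)) * X k ω else 0 := by
          rw [← Finset.sum_filter, Finset.filter_mem_eq_inter, Finset.inter_eq_right.2 hsub,
            blockSum]
        rw [e, ← Finset.sum_sub_distrib]
        refine Finset.sum_congr rfl fun k _ => ?_
        split_ifs <;> ring
      · congr 1
        rw [div_pow, Real.sq_sqrt hs.le, hδ, ← Real.exp_nat_mul]
        have e : Real.exp (-((j : ℝ) + 1)) = Real.exp (-((j : ℝ) + 1) * (1 / 2)) *
            Real.exp ((2 : ℕ) * (-((j : ℝ) + 1) / 4)) := by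
          rw [← Real.exp_add]
          congr 1
          push_cast
          ring
        rw [e]
        field_simp))
  filter_upwards [h1, h2] with ω hω1 hω2
  filter_upwards [hω1, hω2] with j hj1 hj2
  -- The series is at least the threshold in modulus and differs from the block sum by less, so
  -- their signs agree.
  have hj1 := not_lt.1 hj1
  have hj2 := abs_lt.1 (not_le.1 hj2)
  constructor
  · intro h
    rcases le_abs.1 hj1 with h3 | h3 <;> have := div_pos (hδ0 j) (Real.sqrt_pos.2 (sampleOffset_pos j)) <;>
      linarith
  · intro h
    rcases le_abs.1 hj1 with h3 | h3 <;> have := div_pos (hδ0 j) (Real.sqrt_pos.2 (sampleOffset_pos j)) <;>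
      linarith

/-- The normalized coefficients of the `j`-th block sum. -/
noncomputable def blockWeight (j k : ℕ) : ℝ :=
  if k ∈ block j then ((k : ℝ) + 1) ^ (-(1 / 2 + sampleOffset j)) /
    √(∑ i ∈ block j, (((i : ℝ) + 1) ^ (-(1 / 2 + sampleOffset j))) ^ 2) else 0

lemma sum_sq_block_pos (j : ℕ) :
    0 < ∑ i ∈ block j, (((i : ℝ) + 1) ^ (-(1 / 2 + sampleOffset j))) ^ 2 := by
  refine Finset.sum_pos (fun i _ => by positivity) ?_
  rw [block, Finset.nonempty_Ico]
  exact blockStart_strictMono (Nat.lt_succ_self j)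

lemma sum_blockWeight_mul (x : ℕ → ℝ) {j : ℕ} {S : Finset ℕ} (hS : block j ⊆ S) :
    ∑ k ∈ S, blockWeight j k * x k = blockSum x j /
      √(∑ i ∈ block j, (((i : ℝ) + 1) ^ (-(1 / 2 + sampleOffset j))) ^ 2) := by
  rw [blockSum, Finset.sum_div, ← Finset.sum_subset hS]
  · refine Finset.sum_congr rfl fun k hk => ?_
    rw [blockWeight, if_pos hk]
    ring
  · intro k _ hk
    rw [blockWeight, if_neg hk, zero_mul]

lemma sum_blockWeight_sq (j : ℕ) : ∑ k ∈ block j, blockWeight j k ^ 2 = 1 := by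
  have h := sum_sq_block_pos j
  calc ∑ k ∈ block j, blockWeight j k ^ 2
      = ∑ k ∈ block j, (((k : ℝ) + 1) ^ (-(1 / 2 + sampleOffset j))) ^ 2 /
          ∑ i ∈ block j, (((i : ℝ) + 1) ^ (-(1 / 2 + sampleOffset j))) ^ 2 := by
        refine Finset.sum_congr rfl fun k hk => ?_
        rw [blockWeight, if_pos hk, div_pow, Real.sq_sqrt h.le]
    _ = 1 := by rw [← Finset.sum_div, div_self h.ne']

/-- Indicator of a sign change between two consecutive block sums. -/
noncomputable def signChange (x : ℕ → ℝ) (i : ℕ) : ℝ :=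
  Set.indicator (Set.Ioi (0 : ℝ) ×ˢ Set.Iio (0 : ℝ)) (fun _ => (1 : ℝ))
    (blockSum x (2 * i), blockSum x (2 * i + 1))

/-- Normalizing keeps signs, and the weights vanish off the block. Both sums may thus run over the
union of two blocks, as pairwise independence requires. -/
lemma signChange_eq (x : ℕ → ℝ) {i : ℕ} {S T : Finset ℕ} (hS : block (2 * i) ⊆ S)
    (hT : block (2 * i + 1) ⊆ T) :
    signChange x i = Set.indicator (Set.Ioi (0 : ℝ) ×ˢ Set.Iio (0 : ℝ)) (fun _ => (1 : ℝ))
      (∑ k ∈ S, blockWeight (2 * i) k * x k, ∑ k ∈ T, blockWeight (2 * i + 1) k * x k) := by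
  rw [sum_blockWeight_mul x hS, sum_blockWeight_mul x hT, signChange]
  have h1 := Real.sqrt_pos.2 (sum_sq_block_pos (2 * i))
  have h2 := Real.sqrt_pos.2 (sum_sq_block_pos (2 * i + 1))
  simp only [Set.indicator, Set.mem_prod, Set.mem_Ioi, Set.mem_Iio, div_pos_iff_of_pos_right h1,
    div_neg_iff, h2, h2.not_gt, and_true, and_false, false_or]

lemma measurable_indicator_quadrant :
    Measurable (Set.indicator (Set.Ioi (0 : ℝ) ×ˢ Set.Iio (0 : ℝ)) (fun _ => (1 : ℝ))) :=
  measurable_const.indicator (measurableSet_Ioi.prod measurableSet_Iio)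

lemma hasLaw_normalized_block_pair (hm : ∀ n, Measurable (X n))
    (hlaw : ∀ n, HasLaw (X n) (gaussianReal 0 1) P) (hindep : iIndepFun X P) (i : ℕ) :
    HasLaw (fun ω => (∑ k ∈ block (2 * i), blockWeight (2 * i) k * X k ω,
      ∑ k ∈ block (2 * i + 1), blockWeight (2 * i + 1) k * X k ω))
      ((gaussianReal 0 1).prod (gaussianReal 0 1)) P := by
  have h : ∀ j, HasLaw (fun ω => ∑ k ∈ block j, blockWeight j k * X k ω) (gaussianReal 0 1) P := by
    intro j
    have := hasLaw_linear_combination hm hlaw hindep (blockWeight j) (block j)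
    rwa [sum_blockWeight_sq, Real.toNNReal_one] at this
  have hi := (indepFun_linear_combinations hm hindep (disjoint_block (Nat.lt_succ_self (2 * i)))
    (blockWeight (2 * i)) 0 (blockWeight (2 * i + 1)) 0).comp measurable_fst measurable_fst
  exact (indepFun_iff_hasLaw_prodMk_prod (h _) (h _)).1 hi

/-- Almost surely, a positive proportion of pairs of block sums change sign. -/
lemma ae_tendsto_signChange (hm : ∀ n, Measurable (X n))
    (hlaw : ∀ n, HasLaw (X n) (gaussianReal 0 1) P) (hindep : iIndepFun X P) :
    ∃ p : ℝ, 0 < p ∧ ∀ᵐ ω ∂P, Tendsto (fun n : ℕ =>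
      (∑ i ∈ Finset.range n, signChange (fun m => X m ω) i) / n) atTop (𝓝 p) := by
  have hrep : ∀ i, (fun ω => signChange (fun m => X m ω) i) =
      Set.indicator (Set.Ioi (0 : ℝ) ×ˢ Set.Iio (0 : ℝ)) (fun _ => (1 : ℝ)) ∘
      fun ω => (∑ k ∈ block (2 * i), blockWeight (2 * i) k * X k ω,
        ∑ k ∈ block (2 * i + 1), blockWeight (2 * i + 1) k * X k ω) := fun i =>
    funext fun ω => signChange_eq _ subset_rfl subset_rfl
  have hident : ∀ i, IdentDistrib (fun ω => signChange (fun m => X m ω) i)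
      (fun ω => signChange (fun m => X m ω) 0) P P := by
    intro i
    have h1 := hasLaw_normalized_block_pair hm hlaw hindep i
    have h0 := hasLaw_normalized_block_pair hm hlaw hindep 0
    rw [hrep i, hrep 0]
    exact IdentDistrib.comp ⟨h1.aemeasurable, h0.aemeasurable, h1.map_eq.trans h0.map_eq.symm⟩
      measurable_indicator_quadrant
  have hlaw0 := hasLaw_normalized_block_pair hm hlaw hindep 0
  have hint : Integrable (fun ω => signChange (fun m => X m ω) 0) P := by
    refine Integrable.of_bound (C := 1) (hident 0).aemeasurable_fst.aestronglyMeasurable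
      (ae_of_all _ fun ω => ?_)
    rw [signChange, Set.indicator]
    split_ifs <;> simp
  -- Pairwise independence suffices for the strong law; distinct pairs use disjoint blocks.
  have hpair : Pairwise fun i j => IndepFun (fun ω => signChange (fun m => X m ω) i)
      (fun ω => signChange (fun m => X m ω) j) P := by
    have key : ∀ i j, i < j → IndepFun (fun ω => signChange (fun m => X m ω) i)
        (fun ω => signChange (fun m => X m ω) j) P := by
      intro i j hij
      have hd : Disjoint (block (2 * i) ∪ block (2 * i + 1)) (block (2 * j) ∪ block (2 * j + 1)) := by
        rw [Finset.disjoint_union_left, Finset.disjoint_union_right, Finset.disjoint_union_right]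
        exact ⟨⟨disjoint_block (by omega), disjoint_block (by omega)⟩,
          disjoint_block (by omega), disjoint_block (by omega)⟩
      have h := (indepFun_linear_combinations hm hindep hd (blockWeight (2 * i))
        (blockWeight (2 * i + 1)) (blockWeight (2 * j)) (blockWeight (2 * j + 1))).comp
        measurable_indicator_quadrant measurable_indicator_quadrant
      convert h using 1
      · exact funext fun ω => signChange_eq _ Finset.subset_union_left Finset.subset_union_right
      · exact funext fun ω => signChange_eq _ Finset.subset_union_left Finset.subset_union_right
    intro i j hij
    rcases lt_or_gt_of_ne hij with h | h
    · exact key i j h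
    · exact (key j i h).symm
  refine ⟨_, ?_, strong_law_ae_real (fun i ω => signChange (fun m => X m ω) i) hint hpair hident⟩
  have hmeas : MeasurableSet (Set.Ioi (0 : ℝ) ×ˢ Set.Iio (0 : ℝ)) :=
    measurableSet_Ioi.prod measurableSet_Iio
  have hE : ∫ ω, signChange (fun m => X m ω) 0 ∂P =
      ((gaussianReal 0 1).prod (gaussianReal 0 1)).real (Set.Ioi (0 : ℝ) ×ˢ Set.Iio (0 : ℝ)) := by
    have := hlaw0.integral_comp (f := Set.indicator (Set.Ioi (0 : ℝ) ×ˢ Set.Iio (0 : ℝ))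
      (fun _ => (1 : ℝ))) measurable_indicator_quadrant.aestronglyMeasurable
    rw [← hrep 0] at this
    rw [this, integral_indicator_const _ hmeas, smul_eq_mul, mul_one]
  rw [hE, measureReal_prod_prod]
  -- A Gaussian null set is Lebesgue null, so neither half-line is one; the value of `p` is not
  -- needed.
  have hac := gaussianReal_absolutelyContinuous' 0 (one_ne_zero (α := NNReal))
  refine mul_pos ?_ ?_
  · refine ENNReal.toReal_pos (fun h => ?_) (measure_ne_top _ _)
    have := hac h
    simp at this
  · refine ENNReal.toReal_pos (fun h => ?_) (measure_ne_top _ _)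
    have := hac h
    simp at this

end Probability

/-! ### From sign changes to zeros. -/

namespace SqrtCancellation

variable {x : ℕ → ℝ}

/-- Each sign change of the block sums produces a zero, and these zeros are distinct. -/
lemma card_signChange_le_numRealZeros (hx : SqrtCancellation x) {j₀ : ℕ}
    (hsign : ∀ j ≥ j₀,
      (0 < blockSum x j → 0 < (dirichletFun x ((1 / 2 + sampleOffset j : ℝ) : ℂ)).re) ∧
      (blockSum x j < 0 → (dirichletFun x ((1 / 2 + sampleOffset j : ℝ) : ℂ)).re < 0))
    {n : ℕ} {T : ℝ} (hT : T ≤ 1 / 2 + sampleOffset (2 * n)) :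
    (((Finset.Ico j₀ n).filter fun i => 0 < blockSum x (2 * i) ∧ blockSum x (2 * i + 1) < 0).card :
      ℕ∞) ≤ numRealZeros x T := by
  have hzero : ∀ i, j₀ ≤ i ∧ 0 < blockSum x (2 * i) ∧ blockSum x (2 * i + 1) < 0 →
      ∃ σ : ℝ, (1 / 2 + sampleOffset (2 * i + 1) < σ ∧ σ < 1 / 2 + sampleOffset (2 * i)) ∧
        IsRealZero x σ := by
    rintro i ⟨hi, h1, h2⟩
    have hlt := sampleOffset_strictAnti (Nat.lt_succ_self (2 * i))
    rw [Nat.succ_eq_add_one] at hlt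
    have hpos := sampleOffset_pos (2 * i + 1)
    have hc : ContinuousOn (fun σ : ℝ => (dirichletFun x σ).re)
        (Set.Icc (1 / 2 + sampleOffset (2 * i + 1)) (1 / 2 + sampleOffset (2 * i))) :=
      hx.continuousOn_re_dirichletFun.mono fun σ hσ => by
        show 1 / 2 < σ
        linarith [hσ.1]
    obtain ⟨σ, hσ, h0⟩ := intermediate_value_Ioo (by linarith) hc
      ⟨(hsign (2 * i + 1) (by omega)).2 h2, (hsign (2 * i) (by omega)).1 h1⟩
    have hσ2 : 1 / 2 < σ := by linarith [hσ.1]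
    refine ⟨σ, ⟨hσ.1, hσ.2⟩, (hx.isRealZero_iff hσ2).2 ?_⟩
    rw [hx.dirichletFun_ofReal hσ2]
    exact_mod_cast h0
  choose! z hz using hzero
  set I := (Finset.Ico j₀ n).filter fun i => 0 < blockSum x (2 * i) ∧ blockSum x (2 * i + 1) < 0
    with hI
  have hmem : ∀ i ∈ I, (j₀ ≤ i ∧ 0 < blockSum x (2 * i) ∧ blockSum x (2 * i + 1) < 0) ∧ i < n := by
    intro i hi
    rw [hI, Finset.mem_filter, Finset.mem_Ico] at hi
    exact ⟨⟨hi.1.1, hi.2⟩, hi.1.2⟩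
  -- For `i < j` the open intervals containing `z i` and `z j` do not overlap, because `2 * i + 1 ≤
  -- 2 * j`.
  have hanti : ∀ i ∈ I, ∀ j ∈ I, i < j → z j < z i := by
    intro i hi j hj hij
    have h1 := (hz i (hmem i hi).1).1.1
    have h2 := (hz j (hmem j hj).1).1.2
    have h3 := sampleOffset_strictAnti.antitone (show 2 * i + 1 ≤ 2 * j by omega)
    linarith
  have hinj : Set.InjOn z I := by
    intro i hi j hj hij
    by_contra hne
    rcases lt_or_gt_of_ne hne with h | h
    · exact (hanti i hi j hj h).ne' hij
    · exact (hanti j hj i hi h).ne hij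
  rw [← Finset.card_image_of_injOn hinj, ← Set.encard_coe_eq_coe_finsetCard, numRealZeros]
  refine Set.encard_le_encard fun σ hσ => ?_
  obtain ⟨i, hi, rfl⟩ := Finset.mem_image.1 (Finset.mem_coe.1 hσ)
  have h1 := hz i (hmem i hi).1
  have h3 := sampleOffset_strictAnti.antitone (show 2 * i + 1 ≤ 2 * n by have := (hmem i hi).2; omega)
  exact ⟨by linarith [h1.1.1], h1.2⟩

/-- The count is at least `p / 16 * √L`, so the quotient is at least `p / 16 * L ^ ε`. The exponent
`1 / 2 - ε` may be negative. -/
lemma liminf_numRealZeros_eq_top (hx : SqrtCancellation x)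
    (hsign : ∀ᶠ j in atTop,
      (0 < blockSum x j → 0 < (dirichletFun x ((1 / 2 + sampleOffset j : ℝ) : ℂ)).re) ∧
      (blockSum x j < 0 → (dirichletFun x ((1 / 2 + sampleOffset j : ℝ) : ℂ)).re < 0))
    {p : ℝ} (hp : 0 < p)
    (hfreq : Tendsto (fun n : ℕ => (∑ i ∈ Finset.range n, signChange x i) / n) atTop (𝓝 p))
    {ε : ℝ} (hε : 0 < ε) :
    liminf (fun T : ℝ => (numRealZeros x T : ℝ≥0∞) /
        ENNReal.ofReal (logScale T ^ (1 / 2 - ε))) (𝓝[>] (1 / 2 : ℝ)) = ⊤ := by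
  obtain ⟨j₀, hj₀⟩ := eventually_atTop.1 hsign
  obtain ⟨n₀, hn₀⟩ := eventually_atTop.1
    ((hfreq.eventually_const_le (show p / 2 < p by linarith)).and (eventually_ge_atTop 1))
  have hcount : ∀ n ≥ n₀, p / 2 * n - j₀ ≤ (((Finset.Ico j₀ n).filter fun i =>
      0 < blockSum x (2 * i) ∧ blockSum x (2 * i + 1) < 0).card : ℝ) := by
    intro n hn
    obtain ⟨h1, h2⟩ := hn₀ n hn
    have hn0 : (0 : ℝ) < n := by exact_mod_cast h2
    rw [le_div_iff₀ hn0] at h1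
    have h3 : ∑ i ∈ Finset.range n, signChange x i = (((Finset.range n).filter fun i =>
        0 < blockSum x (2 * i) ∧ blockSum x (2 * i + 1) < 0).card : ℝ) := by
      rw [Finset.card_filter]
      push_cast
      refine Finset.sum_congr rfl fun i _ => ?_
      simp [signChange, Set.indicator]
    have h4 : ((Finset.range n).filter fun i =>
        0 < blockSum x (2 * i) ∧ blockSum x (2 * i + 1) < 0) ⊆ Finset.range j₀ ∪
        ((Finset.Ico j₀ n).filter fun i => 0 < blockSum x (2 * i) ∧ blockSum x (2 * i + 1) < 0) := by
      intro i hi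
      simp only [Finset.mem_union, Finset.mem_filter, Finset.mem_range, Finset.mem_Ico] at hi ⊢
      rcases lt_or_ge i j₀ with h | h
      · exact Or.inl h
      · exact Or.inr ⟨⟨h, hi.1⟩, hi.2⟩
    have h5 := (Finset.card_le_card h4).trans (Finset.card_union_le _ _)
    rw [Finset.card_range] at h5
    have h6 := (Nat.cast_le (α := ℝ)).2 h5
    push_cast at h6
    linarith
  have htop : Tendsto (fun T : ℝ => ENNReal.ofReal (p / 16 * logScale T ^ ε)) (𝓝[>] (1 / 2 : ℝ))
      (𝓝 ⊤) :=
    ENNReal.tendsto_ofReal_atTop.comp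
      (((tendsto_rpow_atTop hε).comp tendsto_logScale).const_mul_atTop (by positivity))
  refine (tendsto_nhds_top_mono htop ?_).liminf_eq
  have hsqrt : Tendsto (fun T => √(logScale T)) (𝓝[>] (1 / 2 : ℝ)) atTop :=
    Real.tendsto_sqrt_atTop.comp tendsto_logScale
  filter_upwards [self_mem_nhdsWithin, hsqrt.eventually_ge_atTop 6,
    hsqrt.eventually_ge_atTop (4 * n₀ : ℝ), hsqrt.eventually_ge_atTop (16 * j₀ / p : ℝ)]
    with T hT h6 hn hj
  have hT : 1 / 2 < T := hT
  set L := logScale T with hL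
  have hL0 : 0 < L := Real.sqrt_pos.1 (by linarith)
  have hLsq : √L ^ 2 = L := Real.sq_sqrt hL0.le
  -- Chosen so that `(2 * n + 1) ^ 2 ≤ L`, which puts the sample point of index `2 * n` at or above
  -- `T`.
  set n := ⌊(√L - 1) / 2⌋₊ with hn_def
  have hnle : (n : ℝ) ≤ (√L - 1) / 2 := Nat.floor_le (by linarith)
  have hnge : √L / 4 ≤ n := by
    have := Nat.lt_floor_add_one ((√L - 1) / 2)
    linarith
  have hn_large : n ≥ n₀ := by
    have : (n₀ : ℝ) ≤ n := by linarith
    exact_mod_cast this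
  have hTn : T ≤ 1 / 2 + sampleOffset (2 * n) := by
    have h1 : Real.exp (-L) ≤ sampleOffset (2 * n) := by
      refine Real.exp_le_exp.2 ?_
      push_cast
      nlinarith [(Nat.cast_nonneg n : (0 : ℝ) ≤ n)]
    rw [exp_neg_logScale hT] at h1
    linarith
  have hlow := hx.card_signChange_le_numRealZeros (fun j hj => hj₀ j hj) hTn
  have hc := hcount n hn_large
  set m := ((Finset.Ico j₀ n).filter fun i =>
    0 < blockSum x (2 * i) ∧ blockSum x (2 * i + 1) < 0).card
  -- From `n ≥ √L / 4` the main term is at least `p * √L / 8`; the `j₀` discarded indices cost at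
  -- most half of it.
  have hm : p / 16 * √L ≤ m := by
    rw [div_le_iff₀ hp] at hj
    nlinarith
  rw [ENNReal.le_div_iff_mul_le (Or.inl (by simpa using Real.rpow_pos_of_pos hL0 _))
    (Or.inl ENNReal.ofReal_ne_top), ← ENNReal.ofReal_mul (by positivity), mul_assoc,
    ← Real.rpow_add hL0, add_sub_cancel, ← Real.sqrt_eq_rpow]
  calc ENNReal.ofReal (p / 16 * √L) ≤ ENNReal.ofReal m := ENNReal.ofReal_le_ofReal hm
    _ = ((m : ℕ∞) : ℝ≥0∞) := by simp
    _ ≤ _ := ENat.toENNReal_le.2 hlow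

end SqrtCancellation

theorem theorem3 {Ω : Type*} [MeasurableSpace Ω] (P : Measure Ω) [IsProbabilityMeasure P]
    (X : ℕ → Ω → ℝ) (hlaw : ∀ n, HasLaw (X n) (gaussianReal 0 1) P) (hindep : iIndepFun X P) :
    (∀ᵐ ω ∂P,
      limsup (fun T : ℝ => (numRealZeros (fun n => X n ω) T : ℝ≥0∞) /
        ENNReal.ofReal (logScale T * Real.log (logScale T))) (𝓝[>] (1 / 2 : ℝ)) < ⊤) ∧
    (∀ᵐ ω ∂P, ∀ ε : ℝ, 0 < ε →
      liminf (fun T : ℝ => (numRealZeros (fun n => X n ω) T : ℝ≥0∞) /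
        ENNReal.ofReal (logScale T ^ (1 / 2 - ε))) (𝓝[>] (1 / 2 : ℝ)) = ⊤) := by
  -- `HasLaw` gives only almost everywhere measurability. Measurable versions agree with all the `X
  -- n` at once off a null set.
  set Y : ℕ → Ω → ℝ := fun n => (hlaw n).aemeasurable.mk (X n) with hY
  have hXY : ∀ n, X n =ᵐ[P] Y n := fun n => (hlaw n).aemeasurable.ae_eq_mk
  have hm : ∀ n, Measurable (Y n) := fun n => (hlaw n).aemeasurable.measurable_mk
  have hlawY : ∀ n, HasLaw (Y n) (gaussianReal 0 1) P := fun n => (hlaw n).congr (hXY n).symm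
  have hindepY : iIndepFun Y P := hindep.congr hXY
  have hall : ∀ᵐ ω ∂P, (fun n => X n ω) = fun n => Y n ω := by
    filter_upwards [ae_all_iff.2 hXY] with ω hω
    exact funext hω
  constructor
  · filter_upwards [hall, ae_limsup_numRealZeros_lt_top hm hlawY hindepY] with ω h1 h2
    rw [h1]
    exact h2
  · obtain ⟨p, hp, hfreq⟩ := ae_tendsto_signChange hm hlawY hindepY
    -- None of these events depends on `ε`, so one null set serves every `ε`.
    filter_upwards [hall, ae_sqrtCancellation hm hlawY hindepY,
      ae_eventually_sign_eq hm hlawY hindepY, hfreq] with ω h1 h2 h3 h4 ε hε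
    rw [h1]
    exact h2.liminf_numRealZeros_eq_top h3 hp h4 hε
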